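/- **Setting.** Consider a Markov decision process with state space $\mathcal S$, action space $\mathcal A$, transition law $\mathcal P(\cdot\mid s,a)$, initial law $\rho$, bounded reward $|\mathcal R(s,a)|\le R$, discount factor $\gamma\in[0,1)$ and finite horizon $H$. A parametrized policy has positive densities $\pi_\theta(a\mid s)$, $\theta\in\mathbb R^d$. Let $p(\cdot\mid\theta)$ be the law of the trajectory $\tau=(s_0,a_0,\dots,s_{H-1},a_{H-1})$ under $\pi_\theta$, $\mathcal R(\tau)=\sum_{t=0}^{H-1}\gamma^t\mathcal R(s_t,a_t)$, $J(\theta)=\mathbb E_{\tau\sim p(\cdot\mid\theta)}\mathcal R(\tau)$, $J^*=\sup_\theta J(\theta)$ (which is $J(\theta^*)$ if a maximizer $\theta^*$ exists), and $\omega(\tau\mid\theta_1,\theta_2)=p(\tau\mid\theta_2)/p(\tau\mid\theta_1)$. Assume 1. the trajectory gradient $g(\tau\mid\theta)$ is measurable in $\tau$ and unbiased: $\mathbb E_{\tau\sim p(\cdot\mid\theta)}\,g(\tau\mid\theta)=\nabla J(\theta)$ for all $\theta$; 2. $\theta\mapsto\log\pi_\theta(a\mid s)$ is twice differentiable, with first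 and second partial derivatives bounded uniformly in $s,a,\theta$; 3. $\mathbb E_{\tau\sim p(\cdot\mid\theta)}\|g(\tau\mid\theta)-\nabla J(\theta)\|^2\le\sigma^2$ for all $\theta$, where $\sigma>0$. Let $L,\Gamma,a>0$ and $L_g\ge0$ be constants such that, for all $\theta_1,\theta_2,\theta,\tau$, $$\|\nabla J(\theta_1)-\nabla J(\theta_2)\|\le L\|\theta_1-\theta_2\|,\qquad \|g(\tau\mid\theta_1)-g(\tau\mid\theta_2)\|\le L_g\|\theta_1-\theta_2\|,\qquad \|g(\tau\mid\theta)\|^2\le\Gamma,$$ $$\mathbb E_{\tau\sim p(\cdot\mid\theta_1)}\bigl(1-\omega(\tau\mid\theta_1,\theta_2)\bigr)^2\le a\|\theta_1-\theta_2\|^2,$$ and let $Q=2(L_g^2+\Gamma a)$. **Algorithm.** Given $\theta_0$, $\epsilon>0$ and $\beta\ge0$, take $\eta=\frac1{2L}$, $\alpha=48$, $m=\max\bigl(1,\lfloor(\tfrac{L^2\sigma^2}{Q\epsilon})^{1/3}\rfloor\bigr)$, $B=\lceil(\tfrac{Q\sigma^4}{L^2\epsilon^2})^{1/3}\rceil$,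 $K=\lceil 176L(J^*-J(\theta_0))/\epsilon\rceil$. For $k=0,\dots,K$ let $n_k=\lfloor k/m\rfloor m$. If $m\mid k$, draw $\lceil N\rceil$ independent trajectories from $p(\cdot\mid\theta_k)$, where $$N=\frac{\alpha\sigma^2}{\frac\beta m\sum_{i=n_k-m}^{n_k-1}\|v_i\|^2+\epsilon}\qquad(v_i=0\text{ for }i<0),$$ and let $v_k$ be the average of the $g(\tau_i\mid\theta_k)$. Otherwise draw $B$ independent trajectories from $p(\cdot\mid\theta_k)$ and let $v_k=\frac1B\sum_{i=1}^B\bigl(g(\tau_i\mid\theta_k)-\omega(\tau_i\mid\theta_k,\theta_{n_k})g(\tau_i\mid\theta_{n_k})\bigr)+v_{n_k}$. Put $\theta_{k+1}=\theta_k+\eta v_k$. The output is $\theta_\xi$ with $\xi$ uniform on $\{0,\dots,K\}$ and independent of the run. AbaSVRPG is the case $\beta=6$; vanilla SVRPG is the case $\beta=0$, in which $N=\alpha\sigma^2/\epsilon$. The STO count of a run is the number of trajectory gradients that it computes: $\lceil N\rceil$ in an iteration with $m\mid k$ and $2B$ in any other iteration. The complexity expressions are $$C_{\rm Aba}=2KB+\sum_{k=0}^{\lfloor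 K/m\rfloor}\frac{\alpha\sigma^2}{\frac\beta m\sum_{i=km-m}^{km-1}\|v_i\|^2+\epsilon}\quad(\beta=6),\qquad C_{\rm van}=2KB+\sum_{k=0}^{\lfloor K/m\rfloor}\frac{\alpha\sigma^2}{\epsilon}.$$ **Claim.** If the variances of the importance weights $\omega(\tau\mid\theta_1,\theta_2)$, $\tau\sim p(\cdot\mid\theta_1)$, are bounded uniformly in $\theta_1,\theta_2$, and $g$ is the REINFORCE or the G(PO)MDP trajectory gradient with a bounded measurable baseline, then constants $L,L_g,\Gamma,a$ as above exist. For all such constants (and any $g$ satisfying the assumptions), with $\epsilon>0$ arbitrary unless said otherwise: * both algorithms achieve $\mathbb E\|\nabla J(\theta_\xi)\|^2\le\epsilon$; * the STO count of every run of AbaSVRPG (of vanilla SVRPG) is at most $C_{\rm Aba}$ (respectively $C_{\rm van}$) plus $\lfloor K/m\rfloor+1$, the latter only because the outer batch sizes are rounded up; * $C_{\rm Aba}\le C_{\rm van}$ on every run, with strict inequality if and only if $v_i\ne0$ for some $i<n_K$; * if $\nabla J(\theta_0)\neq0$, then $\mathbb E\,C_{\rm Aba}<C_{\rm van}$ for all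 sufficiently small $\epsilon>0$; * $C_{\rm van}=\mathcal O(\epsilon^{-5/3}+\epsilon^{-1})$ as $\epsilon\to0^+$, and the STO count of AbaSVRPG is $\mathcal O(\epsilon^{-5/3}+\epsilon^{-1})$ uniformly over all runs. -/

import Mathlib

open MeasureTheory ProbabilityTheory Filter Topology Asymptotics

noncomputable section

namespace SVRPG

/-- Policy parameters: `ℝ^d` with the Euclidean norm. -/
abbrev Param (d : ℕ) : Type := EuclideanSpace ℝ (Fin d)

/-- A finite-horizon discounted Markov decision process with bounded rewards. -/
structure MDP (S A : Type*) [MeasurableSpace S] [MeasurableSpace A] where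
  /-- transition law `P(s' | s, a)` -/
  trans : Kernel (S × A) S
  markov : IsMarkovKernel trans
  /-- initial state distribution -/
  init : Measure S
  init_prob : IsProbabilityMeasure init
  reward : S × A → ℝ
  reward_meas : Measurable reward
  reward_bdd : ∃ R : ℝ, ∀ x, |reward x| ≤ R
  /-- discount factor -/
  disc : ℝ
  disc_nonneg : 0 ≤ disc
  disc_lt_one : disc < 1
  /-- number of state-action pairs in a trajectory -/
  horizon : ℕ

/-- A parametrized policy class: `density θ s` is the density of the action chosen in state `s`
with respect to the reference measure `ref` on the action space. -/
structure Policy (S A : Type*) [MeasurableSpace S] [MeasurableSpace A] (d : ℕ) where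
  ref : Measure A
  sigmaFinite : SigmaFinite ref
  density : Param d → S → A → ℝ
  nonneg : ∀ θ s a, 0 ≤ density θ s a
  meas : ∀ θ, Measurable fun x : S × A => density θ x.1 x.2
  lintegral_eq_one : ∀ θ s, ∫⁻ a, ENNReal.ofReal (density θ s a) ∂ref = 1

attribute [instance] MDP.markov MDP.init_prob Policy.sigmaFinite

variable {S A : Type*} [MeasurableSpace S] [MeasurableSpace A] {d : ℕ}

/-- Trajectories `(s₀, a₀, …, s_{H-1}, a_{H-1})`. -/
abbrev MDP.Traj (M : MDP S A) : Type _ := Fin M.horizon → S × A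

/-- The policy `π_θ` as a Markov kernel from states to actions. -/
def Policy.kernel (π : Policy S A d) (θ : Param d) : Kernel S A :=
  Kernel.withDensity (Kernel.const S π.ref) fun s a => ENNReal.ofReal (π.density θ s a)

/-- The law of the next `n` state-action pairs, as a function of the current state. -/
def trajFrom (M : MDP S A) (π : Policy S A d) (θ : Param d) :
    (n : ℕ) → Kernel S (Fin n → S × A)
  | 0 => Kernel.const S (Measure.dirac Fin.elim0)
  | n + 1 =>
      (Kernel.id ×ₖ (π.kernel θ ⊗ₖ (trajFrom M π θ n ∘ₖ M.trans))).map
        fun x => Fin.cons (x.1, x.2.1) x.2.2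

/-- The law `p(· | θ)` of a trajectory: `s₀ ∼ init`, `a_t ∼ π_θ(· | s_t)`,
`s_{t+1} ∼ P(· | s_t, a_t)`. -/
def trajLaw (M : MDP S A) (π : Policy S A d) (θ : Param d) : Measure M.Traj :=
  M.init.bind (trajFrom M π θ M.horizon)

/-- Discounted total reward of a trajectory. -/
def totalReward (M : MDP S A) (τ : M.Traj) : ℝ :=
  ∑ t : Fin M.horizon, M.disc ^ (t : ℕ) * M.reward (τ t)

/-- The objective `J(θ)`, the expected total reward. -/
def objective (M : MDP S A) (π : Policy S A d) (θ : Param d) : ℝ :=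
  ∫ τ, totalReward M τ ∂(trajLaw M π θ)

/-- Importance weight `ω(τ | θ₁, θ₂) = p(τ | θ₂) / p(τ | θ₁)`; the factors of the initial and the
transition law do not depend on the parameter and cancel. -/
def weight (M : MDP S A) (π : Policy S A d) (θ₁ θ₂ : Param d) (τ : M.Traj) : ℝ :=
  ∏ t, π.density θ₂ (τ t).1 (τ t).2 / π.density θ₁ (τ t).1 (τ t).2

/-- `log π_θ(a | s)` as a function of `θ`. -/
def Policy.logDensity (π : Policy S A d) (x : S × A) (θ : Param d) : ℝ :=
  Real.log (π.density θ x.1 x.2)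

/-- The REINFORCE trajectory gradient with baseline `b`. -/
def reinforce (M : MDP S A) (π : Policy S A d) (b : S × A → ℝ) (θ : Param d) (τ : M.Traj) :
    Param d :=
  (∑ t : Fin M.horizon, (M.disc ^ (t : ℕ) * M.reward (τ t) - b (τ t))) •
    (∑ t : Fin M.horizon, gradient (π.logDensity (τ t)) θ)

/-- The G(PO)MDP trajectory gradient with baseline `b`. -/
def gpomdp (M : MDP S A) (π : Policy S A d) (b : S × A → ℝ) (θ : Param d) (τ : M.Traj) :
    Param d :=
  ∑ t : Fin M.horizon, (M.disc ^ (t : ℕ) * M.reward (τ t) - b (τ t)) •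
    (∑ i ∈ Finset.Iic t, gradient (π.logDensity (τ i)) θ)

/-- `g` is one of the two usual trajectory gradients, with a bounded measurable baseline. -/
def IsStandardGradient (M : MDP S A) (π : Policy S A d) (g : Param d → M.Traj → Param d) : Prop :=
  ∃ b : S × A → ℝ, Measurable b ∧ (∃ c : ℝ, ∀ x, |b x| ≤ c) ∧
    (g = reinforce M π b ∨ g = gpomdp M π b)

/-- The trajectory gradient is an unbiased estimator of `∇J`. -/
def Unbiased (M : MDP S A) (π : Policy S A d) (g : Param d → M.Traj → Param d) : Prop :=
  ∀ θ, Integrable (g θ) (trajLaw M π θ) ∧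
    ∫ τ, g θ τ ∂(trajLaw M π θ) = gradient (objective M π) θ

/-- `log π_θ(a | s)` is twice differentiable in `θ`, with first and second partial derivatives
bounded uniformly in `(s, a)` and `θ`. -/
structure SmoothPolicy (π : Policy S A d) : Prop where
  pos : ∀ θ s a, 0 < π.density θ s a
  diff : ∀ x, Differentiable ℝ (π.logDensity x)
  diff_grad : ∀ x, Differentiable ℝ (gradient (π.logDensity x))
  grad_bdd : ∃ G : ℝ, ∀ x θ i, |gradient (π.logDensity x) θ i| ≤ G
  hess_bdd : ∃ F : ℝ, ∀ x θ i j,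
    |fderiv ℝ (gradient (π.logDensity x)) θ (EuclideanSpace.single j 1) i| ≤ F

/-- The variance of the trajectory gradient is at most `σ²`. -/
def BoundedVariance (M : MDP S A) (π : Policy S A d) (g : Param d → M.Traj → Param d) (σ : ℝ) :
    Prop :=
  ∀ θ, Integrable (fun τ => ‖g θ τ - gradient (objective M π) θ‖ ^ 2) (trajLaw M π θ) ∧
    ∫ τ, ‖g θ τ - gradient (objective M π) θ‖ ^ 2 ∂(trajLaw M π θ) ≤ σ ^ 2

/-- The importance weights have uniformly bounded variance. -/
def BoundedWeightVariance (M : MDP S A) (π : Policy S A d) : Prop :=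
  ∃ W : ℝ, ∀ θ₁ θ₂, variance (weight M π θ₁ θ₂) (trajLaw M π θ₁) ≤ W

/-- The constants in terms of which the parameters of the algorithm are chosen: `∇J` is
`L`-Lipschitz, `g` is `Lg`-Lipschitz in `θ` with `‖g‖² ≤ Γ`, and the importance weights satisfy
`E (1 - ω)² ≤ a ‖θ₁ - θ₂‖²`. -/
structure Constants (M : MDP S A) (π : Policy S A d) (g : Param d → M.Traj → Param d)
    (L Lg Γ a : ℝ) : Prop where
  L_pos : 0 < L
  Lg_nonneg : 0 ≤ Lg
  Γ_pos : 0 < Γ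
  a_pos : 0 < a
  lip_J : ∀ θ₁ θ₂,
    ‖gradient (objective M π) θ₁ - gradient (objective M π) θ₂‖ ≤ L * ‖θ₁ - θ₂‖
  lip_g : ∀ τ θ₁ θ₂, ‖g θ₁ τ - g θ₂ τ‖ ≤ Lg * ‖θ₁ - θ₂‖
  bdd_g : ∀ τ θ, ‖g θ τ‖ ^ 2 ≤ Γ
  weight_le : ∀ θ₁ θ₂,
    ∫ τ, (1 - weight M π θ₁ θ₂ τ) ^ 2 ∂(trajLaw M π θ₁) ≤ a * ‖θ₁ - θ₂‖ ^ 2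

/-- The constant `Q = 2 (Lg² + Γ a)`. -/
def msConst (Lg Γ a : ℝ) : ℝ := 2 * (Lg ^ 2 + Γ * a)

/-- Input parameters of the algorithm. `m` is the epoch length, `B` the inner batch size. -/
structure Input where
  η : ℝ
  ε : ℝ
  σ : ℝ
  α : ℝ
  β : ℝ
  m : ℕ
  B : ℕ

/-! A run of the algorithm is encoded by the sequence `v : ℕ → ℝ^d` of its search directions. -/

/-- The iterate `θ_k`, where `θ_{k+1} = θ_k + η v_k`. -/
def iterate (I : Input) (θ₀ : Param d) (v : ℕ → Param d) (k : ℕ) : Param d :=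
  θ₀ + I.η • (∑ i ∈ Finset.range k, v i)

/-- `α σ² / ((β / m) ∑_{i = n - m}^{n - 1} ‖v_i‖² + ε)`, the adaptive batch size before rounding
for an epoch that starts at iteration `n`, a multiple of `m` (for `n = 0` the sum is empty, which
is the convention `v_{-1} = ⋯ = v_{-m} = 0`). -/
def batchReal (I : Input) (v : ℕ → Param d) (n : ℕ) : ℝ :=
  I.α * I.σ ^ 2 / (I.β / I.m * (∑ i ∈ Finset.Ico (n - I.m) n, ‖v i‖ ^ 2) + I.ε)

/-- The adaptive batch size. -/
def batch (I : Input) (v : ℕ → Param d) (n : ℕ) : ℕ := ⌈batchReal I v n⌉₊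

/-- The first iteration `n_k = ⌊k / m⌋ m` of the epoch of iteration `k`. -/
def epochStart (I : Input) (k : ℕ) : ℕ := k / I.m * I.m

/-- The conditional law of `v_k`, given the directions `v_i`, `i < k`. -/
def stepLaw (M : MDP S A) (π : Policy S A d) (g : Param d → M.Traj → Param d) (I : Input)
    (θ₀ : Param d) (k : ℕ) (v : ℕ → Param d) : Measure (Param d) :=
  let θ := iterate I θ₀ v k
  let θs := iterate I θ₀ v (epochStart I k)
  if k % I.m = 0 then
    (Measure.pi fun _ : Fin (batch I v k) => trajLaw M π θ).map
      fun τ => (batch I v k : ℝ)⁻¹ • (∑ i, g θ (τ i))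
  else
    (Measure.pi fun _ : Fin I.B => trajLaw M π θ).map
      fun τ => (I.B : ℝ)⁻¹ • (∑ i, (g θ (τ i) - weight M π θ θs (τ i) • g θs (τ i))) +
        v (epochStart I k)

/-- The joint law of `v_0, …, v_{n-1}` (the later entries of the sequence are `0`). -/
def runLaw (M : MDP S A) (π : Policy S A d) (g : Param d → M.Traj → Param d) (I : Input)
    (θ₀ : Param d) : ℕ → Measure (ℕ → Param d)
  | 0 => Measure.dirac 0
  | k + 1 => (runLaw M π g I θ₀ k).bind fun v =>
      (stepLaw M π g I θ₀ k v).map fun x => Function.update v k x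

/-- The law of the output `θ_ξ` after the iterations `0, …, K`, where `ξ` is independent of the run
and uniform on `{0, …, K}`. -/
def outputLaw (M : MDP S A) (π : Policy S A d) (g : Param d → M.Traj → Param d) (I : Input)
    (θ₀ : Param d) (K : ℕ) : Measure (Param d) :=
  ((runLaw M π g I θ₀ (K + 1)).prod (PMF.uniformOfFintype (Fin (K + 1))).toMeasure).map
    fun x => iterate I θ₀ x.1 x.2

/-- The output of the algorithm is a (genuine) random variable with `E ‖∇J(θ_ξ)‖² ≤ ε`. -/
def IsAccurate (M : MDP S A) (π : Policy S A d) (g : Param d → M.Traj → Param d) (I : Input)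
    (θ₀ : Param d) (K : ℕ) : Prop :=
  IsProbabilityMeasure (outputLaw M π g I θ₀ K) ∧
  Integrable (fun θ => ‖gradient (objective M π) θ‖ ^ 2) (outputLaw M π g I θ₀ K) ∧
  ∫ θ, ‖gradient (objective M π) θ‖ ^ 2 ∂(outputLaw M π g I θ₀ K) ≤ I.ε

/-- The number of trajectory-gradient computations in the iterations `0, …, K` of a run:
one per trajectory in an outer iteration, two per trajectory in an inner iteration. -/
def stoCount (I : Input) (K : ℕ) (v : ℕ → Param d) : ℕ :=
  ∑ k ∈ Finset.range (K + 1), if k % I.m = 0 then batch I v k else 2 * I.B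

/-- The complexity expression
`2 K B + ∑_{k = 0}^{⌊K / m⌋} α σ² / ((β / m) ∑_{i = k m - m}^{k m - 1} ‖v_i‖² + ε)`. -/
def stoComplexity (I : Input) (K : ℕ) (v : ℕ → Param d) : ℝ :=
  2 * K * I.B + ∑ k ∈ Finset.range (K / I.m + 1), batchReal I v (k * I.m)

/-- `η = 1 / (2 L)`, `m = (L² σ² / (Q ε))^{1/3}`, `B = (Q σ⁴ / (L² ε²))^{1/3}`, `α = 48`, with `m`
rounded down (but at least `1`) and `B` rounded up. -/
def paramChoice (L Q σ β ε : ℝ) : Input where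
  η := 1 / (2 * L)
  ε := ε
  σ := σ
  α := 48
  β := β
  m := max 1 ⌊(L ^ 2 * σ ^ 2 / (Q * ε)) ^ (1 / 3 : ℝ)⌋₊
  B := ⌈(Q * σ ^ 4 / (L ^ 2 * ε ^ 2)) ^ (1 / 3 : ℝ)⌉₊

/-- The input of AbaSVRPG: `β = 6`. -/
def aba (L Q σ ε : ℝ) : Input := paramChoice L Q σ 6 ε

/-- The input of vanilla SVRPG: the same parameters without adaptation, `β = 0`, so that every
outer batch has the size `α σ² / ε`. -/
def vanilla (L Q σ ε : ℝ) : Input := paramChoice L Q σ 0 ε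

/-- `K = 176 L (J* - J(θ₀)) / ε`, rounded up, where `J*` is the supremum of `J`. -/
def numIter (M : MDP S A) (π : Policy S A d) (θ₀ : Param d) (L ε : ℝ) : ℕ :=
  ⌈176 * L * ((⨆ θ, objective M π θ) - objective M π θ₀) / ε⌉₊

end SVRPG

end

noncomputable section

namespace SVRPG

variable {S A : Type*} [MeasurableSpace S] [MeasurableSpace A] {d : ℕ}

/-! ### Policies with Lipschitz log-densities -/

/-! Write `V k = ‖v_k‖²` and let `E k` be the squared error of `v_k` as an estimate of `∇J(θ_k)`.
Accuracy rests on two inequalities between them. Ascent for an `L`-smooth function with step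
`1/(2L)` gives, on every run, `∑ (2‖∇J(θ_k)‖² + V k - 2 E k) ≤ 8L (J* - J(θ₀))`
(`sum_gradient_sq_le`). In expectation, over `n` steps, `∑ E k ≤ nε/48 + (3/8) ∑ V k`
(`sum_error_le`), so the errors use up only part of the `V` already present in the ascent
inequality, and `∑ E‖∇J(θ_k)‖² ≤ 4L (J* - J(θ₀)) + nε/48`.

The error inequality starts from the bias-variance identity for a sample mean, applied conditionally
on the past. An outer step has variance at most `σ²/N`, which by the choice of `N` is at most `1/48`
of `ε` plus `β/m` times the `V` of the preceding epoch. An inner step inherits the error of its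
epoch start, because importance weighting makes the correction unbiased, and adds at most `Q‖θ_k -
θ_{n_k}‖²/B`, which is controlled by the `V` of the current epoch. Each `V i` is charged by at most
`m` steps of each kind, at total cost at most `β/48 ≤ 1/8` and `Qη²m²/B ≤ 1/4`. The second bound is
what the cube roots defining `m` and `B` are tuned for.

The constants exist because the log-densities have bounded and Lipschitz gradients: `g` is a bounded
combination of scores, the weight is the exponential of a Lipschitz function of `θ₂`, and `∇J(θ₁) -
∇J(θ₂)` is the mean of a vector with second moment at most `Q‖θ₁ - θ₂‖²`, so `L = √Q` works.

Adaptive batches never exceed vanilla ones and are smaller exactly when the preceding epoch moved.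
Equality in expectation would force `v_0 = 0` almost surely, so the error of step `0` would be
`‖∇J(θ₀)‖²`, contradicting its bound `ε/48` for small `ε`. The rates come from `K ≲ ε⁻¹`, `B ≲
ε^(-2/3)` and `m ≳ ε^(-1/3)`. -/

lemma norm_le_sum_abs (x : Param d) : ‖x‖ ≤ ∑ i, |x i| := by
  rw [EuclideanSpace.norm_eq]
  refine Real.sqrt_le_iff.2 ⟨Finset.sum_nonneg fun i _ => abs_nonneg _, ?_⟩
  simp only [Real.norm_eq_abs]
  exact Finset.sum_sq_le_sq_sum_of_nonneg fun i _ => abs_nonneg _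

lemma norm_clm_le_of_entries (T : Param d →L[ℝ] Param d) {F : ℝ} (hF : 0 ≤ F)
    (h : ∀ i j, |T (EuclideanSpace.single j 1) i| ≤ F) : ‖T‖ ≤ d * (d * F) := by
  refine T.opNorm_le_bound (by positivity) fun x => ?_
  have hx : x = ∑ j, x j • EuclideanSpace.single j (1 : ℝ) := by
    ext i
    simp [Pi.single_apply]
  have hcol : ∀ j, ‖T (EuclideanSpace.single j 1)‖ ≤ d * F := fun j =>
    (norm_le_sum_abs _).trans <|
      (Finset.sum_le_sum fun i _ => h i j).trans (by simp)
  calc ‖T x‖ = ‖∑ j, x j • T (EuclideanSpace.single j 1)‖ := by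
        conv_lhs => rw [hx]
        simp only [map_sum, map_smul]
    _ ≤ ∑ j : Fin d, ‖x‖ * (d * F) := by
        refine norm_sum_le_of_le _ fun j _ => ?_
        rw [norm_smul]
        exact mul_le_mul (PiLp.norm_apply_le x j) (hcol j) (norm_nonneg _) (norm_nonneg _)
    _ = d * (d * F) * ‖x‖ := by simp; ring

lemma norm_gradient_eq (f : Param d → ℝ) (θ : Param d) : ‖gradient f θ‖ = ‖fderiv ℝ f θ‖ := by
  simp [gradient]

lemma SmoothPolicy.exists_score_bound {π : Policy S A d} (h : SmoothPolicy π) :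
    ∃ D : ℝ, 0 ≤ D ∧ ∀ x θ, ‖gradient (π.logDensity x) θ‖ ≤ D := by
  obtain ⟨G, hG⟩ := h.grad_bdd
  refine ⟨d * |G|, by positivity, fun x θ => (norm_le_sum_abs _).trans ?_⟩
  exact (Finset.sum_le_sum fun i _ => (hG x θ i).trans (le_abs_self G)).trans (by simp)

lemma SmoothPolicy.exists_score_lipschitz {π : Policy S A d} (h : SmoothPolicy π) :
    ∃ F : ℝ, 0 ≤ F ∧ ∀ x θ₁ θ₂,
      ‖gradient (π.logDensity x) θ₁ - gradient (π.logDensity x) θ₂‖ ≤ F * ‖θ₁ - θ₂‖ := by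
  obtain ⟨F, hF⟩ := h.hess_bdd
  refine ⟨d * (d * |F|), by positivity, fun x θ₁ θ₂ => ?_⟩
  refine Convex.norm_image_sub_le_of_norm_fderiv_le (𝕜 := ℝ) (s := Set.univ)
    (fun θ _ => h.diff_grad x θ) (fun θ _ => ?_) convex_univ (Set.mem_univ _) (Set.mem_univ _)
  exact norm_clm_le_of_entries _ (abs_nonneg F) fun i j => (hF x θ i j).trans (le_abs_self F)

lemma SmoothPolicy.abs_logDensity_sub_le {π : Policy S A d} (h : SmoothPolicy π) {D : ℝ}
    (hD : ∀ x θ, ‖gradient (π.logDensity x) θ‖ ≤ D) (x : S × A) (θ₁ θ₂ : Param d) :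
    |π.logDensity x θ₁ - π.logDensity x θ₂| ≤ D * ‖θ₁ - θ₂‖ := by
  rw [← Real.norm_eq_abs]
  exact Convex.norm_image_sub_le_of_norm_fderiv_le (𝕜 := ℝ) (s := Set.univ)
    (fun θ _ => h.diff x θ) (fun θ _ => norm_gradient_eq (π.logDensity x) θ ▸ hD x θ)
    convex_univ (Set.mem_univ _) (Set.mem_univ _)

lemma SmoothPolicy.continuous_density {π : Policy S A d} (h : SmoothPolicy π) (s : S) (a : A) :
    Continuous fun θ => π.density θ s a := by
  have : (fun θ => π.density θ s a) = fun θ => Real.exp (π.logDensity (s, a) θ) := by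
    funext θ
    exact (Real.exp_log (h.pos θ s a)).symm
  rw [this]
  exact Real.continuous_exp.comp (h.diff (s, a)).continuous

lemma measurable_logDensity (π : Policy S A d) (θ : Param d) :
    Measurable fun x => π.logDensity x θ :=
  Real.measurable_log.comp (π.meas θ)

lemma fderiv_apply_eq_inner_gradient (f : Param d → ℝ) (θ v : Param d) :
    fderiv ℝ f θ v = inner ℝ (gradient f θ) v := by
  rw [gradient, InnerProductSpace.toDual_symm_apply]

/-- Each partial derivative is the pointwise limit of difference quotients, which are measurable in
the state-action pair because the densities are. -/
lemma SmoothPolicy.measurable_score {π : Policy S A d} (h : SmoothPolicy π) (θ : Param d) :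
    Measurable fun x => gradient (π.logDensity x) θ := by
  have hcoord : ∀ i, Measurable fun x => gradient (π.logDensity x) θ i := by
    intro i
    have hlim : ∀ x, Tendsto (fun n : ℕ => (n : ℝ) •
        (π.logDensity x (θ + (n : ℝ)⁻¹ • EuclideanSpace.single i 1) - π.logDensity x θ)) atTop
        (𝓝 (gradient (π.logDensity x) θ i)) := by
      intro x
      have := ((h.diff x θ).hasFDerivAt.lim_real (EuclideanSpace.single i 1)).comp
        tendsto_natCast_atTop_atTop
      rw [fderiv_apply_eq_inner_gradient, EuclideanSpace.inner_single_right] at this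
      simpa [Function.comp_def] using this
    refine measurable_of_tendsto_metrizable (fun n => ?_) (tendsto_pi_nhds.2 hlim)
    exact ((measurable_logDensity π _).sub (measurable_logDensity π θ)).const_smul (n : ℝ)
  exact (WithLp.measurable_toLp 2 (Fin d → ℝ)).comp (measurable_pi_lambda _ hcoord)

/-! ### Importance weights -/

section Weight

variable (M : MDP S A) {π : Policy S A d}

lemma SmoothPolicy.weight_pos (h : SmoothPolicy π) (θ₁ θ₂ : Param d) (τ : M.Traj) :
    0 < weight M π θ₁ θ₂ τ :=
  Finset.prod_pos fun _ _ => div_pos (h.pos _ _ _) (h.pos _ _ _)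

lemma SmoothPolicy.weight_eq_exp (h : SmoothPolicy π) (θ₁ θ₂ : Param d) (τ : M.Traj) :
    weight M π θ₁ θ₂ τ =
      Real.exp (∑ t, (π.logDensity (τ t) θ₂ - π.logDensity (τ t) θ₁)) := by
  rw [weight, Real.exp_sum]
  refine Finset.prod_congr rfl fun t _ => ?_
  rw [Real.exp_sub, Policy.logDensity, Policy.logDensity, Real.exp_log (h.pos _ _ _),
    Real.exp_log (h.pos _ _ _)]

lemma SmoothPolicy.abs_log_weight_le (h : SmoothPolicy π) {D : ℝ}
    (hD : ∀ x θ, ‖gradient (π.logDensity x) θ‖ ≤ D) (θ₁ θ₂ : Param d) (τ : M.Traj) :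
    |∑ t, (π.logDensity (τ t) θ₂ - π.logDensity (τ t) θ₁)| ≤
      M.horizon * D * ‖θ₁ - θ₂‖ := by
  refine (Finset.abs_sum_le_sum_abs _ _).trans ?_
  refine (Finset.sum_le_sum fun t _ => h.abs_logDensity_sub_le hD (τ t) θ₂ θ₁).trans ?_
  rw [norm_sub_rev θ₂ θ₁]
  simp [mul_assoc]

lemma SmoothPolicy.weight_le_exp (h : SmoothPolicy π) {D : ℝ}
    (hD : ∀ x θ, ‖gradient (π.logDensity x) θ‖ ≤ D) (θ₁ θ₂ : Param d) (τ : M.Traj) :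
    weight M π θ₁ θ₂ τ ≤ Real.exp (M.horizon * D * ‖θ₁ - θ₂‖) := by
  rw [h.weight_eq_exp M]
  exact Real.exp_le_exp.2 ((le_abs_self _).trans (h.abs_log_weight_le M hD θ₁ θ₂ τ))

lemma SmoothPolicy.exists_weight_bound (h : SmoothPolicy π) (θ₁ θ₂ : Param d) :
    ∃ C : ℝ, ∀ τ, |weight M π θ₁ θ₂ τ| ≤ C := by
  obtain ⟨D, -, hD⟩ := h.exists_score_bound
  refine ⟨Real.exp (M.horizon * D * ‖θ₁ - θ₂‖), fun τ => ?_⟩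
  rw [abs_of_pos (h.weight_pos M θ₁ θ₂ τ)]
  exact h.weight_le_exp M hD θ₁ θ₂ τ

lemma measurable_weight (π : Policy S A d) (θ₁ θ₂ : Param d) : Measurable (weight M π θ₁ θ₂) :=
  Finset.measurable_prod _ fun t _ =>
    ((π.meas θ₂).comp (measurable_pi_apply t)).div ((π.meas θ₁).comp (measurable_pi_apply t))

lemma SmoothPolicy.continuous_weight (h : SmoothPolicy π) (τ : M.Traj) :
    Continuous fun p : Param d × Param d => weight M π p.1 p.2 τ :=
  continuous_finsetProd _ fun _ _ =>
    ((h.continuous_density _ _).comp continuous_snd).div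
      ((h.continuous_density _ _).comp continuous_fst) fun _ => (h.pos _ _ _).ne'

/-- Carathéodory functions, continuous in the parameters and measurable in the trajectory, are
jointly measurable. Joint measurability is needed because the iterates are random. -/
lemma SmoothPolicy.measurable_uncurry_weight (h : SmoothPolicy π) :
    Measurable fun q : (Param d × Param d) × M.Traj => weight M π q.1.1 q.1.2 q.2 :=
  measurable_uncurry_of_continuous_of_measurable (u := fun (p : Param d × Param d) τ => weight M π p.1 p.2 τ)
    (fun τ => h.continuous_weight M τ) fun p => measurable_weight M π p.1 p.2

end Weight

/-! ### The law of a trajectory and its dependence on the parameter -/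

section TrajLaw

variable (M : MDP S A) (π : Policy S A d)

lemma measurable_density_param (θ : Param d) :
    Measurable (Function.uncurry fun (s : S) (a : A) => ENNReal.ofReal (π.density θ s a)) :=
  (π.meas θ).ennreal_ofReal

lemma lintegral_policy_kernel (θ : Param d) (s : S) {f : A → ENNReal} (hf : Measurable f) :
    ∫⁻ a, f a ∂(π.kernel θ s) = ∫⁻ a, ENNReal.ofReal (π.density θ s a) * f a ∂π.ref := by
  rw [Policy.kernel, Kernel.lintegral_withDensity _ (measurable_density_param π θ) s hf]
  simp

instance isMarkovKernel_policy (θ : Param d) : IsMarkovKernel (π.kernel θ) where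
  isProbabilityMeasure s := ⟨by
    have := lintegral_policy_kernel π θ s (f := 1) measurable_one
    simpa [π.lintegral_eq_one] using this⟩

lemma measurable_cons_traj (n : ℕ) :
    Measurable fun x : S × A × (Fin n → S × A) =>
      (Fin.cons (x.1, x.2.1) x.2.2 : Fin (n + 1) → S × A) := by
  refine measurable_pi_lambda _ fun i => ?_
  refine Fin.cases ?_ (fun j => ?_) i
  · simpa using measurable_fst.prodMk (measurable_fst.comp measurable_snd)
  · simpa [Function.comp_def] using
      (measurable_pi_apply j).comp (measurable_snd.comp measurable_snd)

instance isMarkovKernel_trajFrom (θ : Param d) :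
    ∀ n, IsMarkovKernel (trajFrom M π θ n)
  | 0 => by unfold trajFrom; infer_instance
  | n + 1 => by
    have := isMarkovKernel_trajFrom θ n
    unfold trajFrom
    exact Kernel.IsMarkovKernel.map _ (measurable_cons_traj n)

instance isProbabilityMeasure_trajLaw (θ : Param d) : IsProbabilityMeasure (trajLaw M π θ) := by
  unfold trajLaw
  infer_instance

lemma lintegral_trajFrom_succ (θ : Param d) (n : ℕ) (s : S) {f : (Fin (n + 1) → S × A) → ENNReal}
    (hf : Measurable f) :
    ∫⁻ τ, f τ ∂(trajFrom M π θ (n + 1) s) =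
      ∫⁻ a, ENNReal.ofReal (π.density θ s a) *
        ∫⁻ s', ∫⁻ τ, f (Fin.cons (s, a) τ) ∂(trajFrom M π θ n s') ∂(M.trans (s, a)) ∂π.ref := by
  have hf' : Measurable fun x : S × A × (Fin n → S × A) => f (Fin.cons (x.1, x.2.1) x.2.2) :=
    hf.comp (measurable_cons_traj n)
  rw [trajFrom, Kernel.lintegral_map _ (measurable_cons_traj n) _ hf,
    Kernel.lintegral_id_prod hf', Kernel.lintegral_compProd _ _ _
      (show Measurable fun y : A × (Fin n → S × A) => f (Fin.cons (s, y.1) y.2) from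
        hf'.comp measurable_prodMk_left)]
  have hm : Measurable fun a => ∫⁻ τ, f (Fin.cons (s, a) τ)
      ∂((trajFrom M π θ n ∘ₖ M.trans) (s, a)) :=
    ((hf'.comp measurable_prodMk_left).lintegral_kernel_prod_right'
      (κ := (trajFrom M π θ n ∘ₖ M.trans).comap (fun a : A => (s, a)) measurable_prodMk_left))
  refine (lintegral_policy_kernel π θ s hm).trans (lintegral_congr fun a => ?_)
  rw [Kernel.lintegral_comp _ _ _
    (show Measurable fun τ : Fin n → S × A => f (Fin.cons (s, a) τ) from
      hf'.comp (f := fun τ => (s, a, τ)) (by fun_prop))]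

variable {π}

/-- Induction on the number of steps: changing the parameter affects only the action densities, so
each step contributes one density ratio while the transition kernel stays the same. -/
lemma SmoothPolicy.lintegral_trajFrom_eq (h : SmoothPolicy π) (θ₁ θ₂ : Param d) (n : ℕ) (s : S)
    {f : (Fin n → S × A) → ENNReal} (hf : Measurable f) :
    ∫⁻ τ, f τ ∂(trajFrom M π θ₂ n s) =
      ∫⁻ τ, (∏ t, ENNReal.ofReal (π.density θ₂ (τ t).1 (τ t).2 / π.density θ₁ (τ t).1 (τ t).2)) *
        f τ ∂(trajFrom M π θ₁ n s) := by
  have hr : Measurable fun x : S × A =>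
      ENNReal.ofReal (π.density θ₂ x.1 x.2 / π.density θ₁ x.1 x.2) :=
    ((π.meas θ₂).div (π.meas θ₁)).ennreal_ofReal
  have hw : ∀ n, Measurable fun τ : Fin n → S × A => ∏ t, ENNReal.ofReal
      (π.density θ₂ (τ t).1 (τ t).2 / π.density θ₁ (τ t).1 (τ t).2) := fun n =>
    Finset.measurable_prod _ fun t _ => hr.comp (measurable_pi_apply t)
  induction n generalizing s with
  | zero => simp [trajFrom]
  | succ n ih =>
    have hcons : ∀ a : A, Measurable fun τ : Fin n → S × A =>
        (Fin.cons (s, a) τ : Fin (n + 1) → S × A) := fun a =>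
      (measurable_cons_traj n).comp (measurable_const.prodMk measurable_prodMk_left)
    rw [lintegral_trajFrom_succ M π θ₂ n s hf,
      lintegral_trajFrom_succ M π θ₁ n s (f := fun τ => (∏ t, ENNReal.ofReal
        (π.density θ₂ (τ t).1 (τ t).2 / π.density θ₁ (τ t).1 (τ t).2)) * f τ)
        ((hw (n + 1)).mul hf)]
    refine lintegral_congr fun a => ?_
    have hpos := h.pos θ₁ s a
    have hmul : ENNReal.ofReal (π.density θ₂ s a) = ENNReal.ofReal (π.density θ₁ s a) *
        ENNReal.ofReal (π.density θ₂ s a / π.density θ₁ s a) := by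
      rw [← ENNReal.ofReal_mul hpos.le, mul_div_cancel₀ _ hpos.ne']
    rw [hmul, mul_assoc, ← lintegral_const_mul' _ _ ENNReal.ofReal_ne_top]
    congr 1
    refine lintegral_congr fun s' => ?_
    rw [ih s' (f := fun τ => f (Fin.cons (s, a) τ)) (hf.comp (hcons a)), ← lintegral_const_mul' _ _ ENNReal.ofReal_ne_top]
    refine lintegral_congr fun τ => ?_
    simp only [Fin.prod_univ_succ, Fin.cons_zero, Fin.cons_succ, mul_assoc]

/-- Change of measure between two policies of the class. -/
lemma SmoothPolicy.trajLaw_eq_withDensity (h : SmoothPolicy π) (θ₁ θ₂ : Param d) :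
    trajLaw M π θ₂ =
      (trajLaw M π θ₁).withDensity fun τ => ENNReal.ofReal (weight M π θ₁ θ₂ τ) := by
  have hw : Measurable fun τ => ENNReal.ofReal (weight M π θ₁ θ₂ τ) :=
    (measurable_weight M π θ₁ θ₂).ennreal_ofReal
  refine Measure.ext_of_lintegral _ fun f hf => ?_
  rw [lintegral_withDensity_eq_lintegral_mul _ hw hf, trajLaw, trajLaw,
    Measure.lintegral_bind (Kernel.aemeasurable _) hf.aemeasurable,
    Measure.lintegral_bind (Kernel.aemeasurable _) (hw.mul hf).aemeasurable]
  refine lintegral_congr fun s => ?_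
  rw [h.lintegral_trajFrom_eq M θ₁ θ₂ _ s hf]
  refine lintegral_congr fun τ => ?_
  rw [Pi.mul_apply, weight, ENNReal.ofReal_prod_of_nonneg]
  exact fun t _ => div_nonneg (π.nonneg _ _ _) (π.nonneg _ _ _)

lemma SmoothPolicy.integral_trajLaw_eq (h : SmoothPolicy π) {E : Type*} [NormedAddCommGroup E]
    [NormedSpace ℝ E] (θ₁ θ₂ : Param d) (f : M.Traj → E) :
    ∫ τ, f τ ∂(trajLaw M π θ₂) = ∫ τ, weight M π θ₁ θ₂ τ • f τ ∂(trajLaw M π θ₁) := by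
  rw [h.trajLaw_eq_withDensity M θ₁ θ₂, integral_withDensity_eq_integral_toReal_smul
    (measurable_weight M π θ₁ θ₂).ennreal_ofReal (by simp)]
  simp only [ENNReal.toReal_ofReal (h.weight_pos M θ₁ θ₂ _).le]

/-- All laws are dominated by the one at parameter `0`, so the probability of an event is the
integral of a jointly measurable weight against a fixed measure. -/
lemma SmoothPolicy.measurable_trajLaw (h : SmoothPolicy π) : Measurable (trajLaw M π) := by
  refine Measure.measurable_of_measurable_coe _ fun s hs => ?_
  have : (fun θ => trajLaw M π θ s) = fun θ =>
      ∫⁻ τ in s, ENNReal.ofReal (weight M π 0 θ τ) ∂(trajLaw M π 0) := by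
    funext θ
    rw [h.trajLaw_eq_withDensity M 0 θ, withDensity_apply _ hs]
  rw [this]
  refine Measurable.lintegral_prod_right' (f := fun q : Param d × M.Traj =>
    ENNReal.ofReal (weight M π 0 q.1 q.2)) ?_
  exact ((h.measurable_uncurry_weight M).comp
    ((measurable_const.prodMk measurable_fst).prodMk measurable_snd)).ennreal_ofReal

lemma SmoothPolicy.integral_weight (h : SmoothPolicy π) (θ₁ θ₂ : Param d) :
    ∫ τ, weight M π θ₁ θ₂ τ ∂(trajLaw M π θ₁) = 1 := by
  have := h.integral_trajLaw_eq M θ₁ θ₂ fun _ => (1 : ℝ)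
  simpa using this.symm

/-! ### Smoothness of the objective -/

lemma measurable_totalReward : Measurable (totalReward M) :=
  Finset.measurable_sum _ fun t _ => (M.reward_meas.comp (measurable_pi_apply t)).const_mul _

lemma exists_totalReward_bound : ∃ C : ℝ, ∀ τ, |totalReward M τ| ≤ C := by
  obtain ⟨R, hR⟩ := M.reward_bdd
  refine ⟨∑ _t : Fin M.horizon, |R|, fun τ => (Finset.abs_sum_le_sum_abs _ _).trans
    (Finset.sum_le_sum fun t _ => ?_)⟩
  rw [abs_mul, abs_of_nonneg (pow_nonneg M.disc_nonneg _)]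
  calc M.disc ^ (t : ℕ) * |M.reward (τ t)| ≤ 1 * |M.reward (τ t)| :=
        mul_le_mul_of_nonneg_right (pow_le_one₀ M.disc_nonneg M.disc_lt_one.le) (abs_nonneg _)
    _ ≤ |R| := by rw [one_mul]; exact (hR _).trans (le_abs_self R)

variable (π) in
lemma bddAbove_objective : BddAbove (Set.range (objective M π)) := by
  obtain ⟨C, hC⟩ := exists_totalReward_bound M
  refine ⟨C, ?_⟩
  rintro _ ⟨θ, rfl⟩
  have := norm_integral_le_of_norm_le_const (μ := trajLaw M π θ) (f := totalReward M)
    (Eventually.of_forall hC)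
  exact (le_abs_self _).trans (by simpa [objective] using this)

lemma SmoothPolicy.hasFDerivAt_weight (h : SmoothPolicy π) (θ₁ θ₂ : Param d) (τ : M.Traj) :
    HasFDerivAt (fun θ => weight M π θ₁ θ τ)
      (weight M π θ₁ θ₂ τ • ∑ t, fderiv ℝ (π.logDensity (τ t)) θ₂) θ₂ := by
  simp only [h.weight_eq_exp M]
  exact (HasFDerivAt.fun_sum fun t _ =>
    (h.diff (τ t) θ₂).hasFDerivAt.sub_const (π.logDensity (τ t) θ₁)).exp

/-- Change of measure moves the dependence on `θ` from the law into the weight, which is then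
differentiated under the integral. This has to be proved separately, since `gradient` takes a
default value where the function is not differentiable. -/
lemma SmoothPolicy.differentiable_objective (h : SmoothPolicy π) :
    Differentiable ℝ (objective M π) := by
  intro θ₀
  obtain ⟨D, hD0, hD⟩ := h.exists_score_bound
  obtain ⟨C, hC⟩ := exists_totalReward_bound M
  have hobj : objective M π = fun θ => ∫ τ, weight M π θ₀ θ τ * totalReward M τ
      ∂(trajLaw M π θ₀) := by
    funext θ
    exact h.integral_trajLaw_eq M θ₀ θ _
  rw [hobj]
  have hmeas : ∀ θ, Measurable fun τ => weight M π θ₀ θ τ * totalReward M τ := fun θ =>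
    (measurable_weight M π θ₀ θ).mul (measurable_totalReward M)
  have hfd : ∀ x : S × A, ∀ θ,
      fderiv ℝ (π.logDensity x) θ = InnerProductSpace.toDual ℝ _ (gradient (π.logDensity x) θ) :=
    fun x θ => by simp [gradient]
  refine (hasFDerivAt_integral_of_dominated_of_fderiv_le (𝕜 := ℝ)
    (F' := fun θ τ => totalReward M τ • (weight M π θ₀ θ τ •
      ∑ t, fderiv ℝ (π.logDensity (τ t)) θ))
    -- On the unit ball around `θ₀` the weight is at most `exp(H·D)` and the summed scores have norm
    -- at most `H·D`.
    (bound := fun _ => C * (Real.exp (M.horizon * D) * (M.horizon * D)))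
    (Metric.ball_mem_nhds θ₀ one_pos) (Eventually.of_forall fun θ => (hmeas θ).aestronglyMeasurable)
    ?_ ?_ ?_ (integrable_const _) ?_).differentiableAt
  · refine Integrable.of_bound (C := C) (hmeas θ₀).aestronglyMeasurable
      (Eventually.of_forall fun τ => ?_)
    have : weight M π θ₀ θ₀ τ = 1 := by simp [h.weight_eq_exp M]
    simpa [this] using hC τ
  · refine ((measurable_totalReward M).smul ((measurable_weight M π θ₀ θ₀).smul
      (Finset.measurable_sum _ fun t _ => ?_))).aestronglyMeasurable
    simp only [hfd]
    exact (InnerProductSpace.toDual ℝ (Param d)).continuous.measurable.comp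
      ((h.measurable_score θ₀).comp (measurable_pi_apply t))
  · refine Eventually.of_forall fun τ θ hθ => ?_
    have hC0 : 0 ≤ C := (abs_nonneg _).trans (hC τ)
    rw [norm_smul, norm_smul, Real.norm_eq_abs, Real.norm_eq_abs,
      abs_of_pos (h.weight_pos M _ _ _)]
    refine mul_le_mul (hC τ) (mul_le_mul ?_ ?_ (norm_nonneg _) (Real.exp_pos _).le)
      (mul_nonneg (h.weight_pos M _ _ _).le (norm_nonneg _)) hC0
    · refine (h.weight_le_exp M hD θ₀ θ τ).trans (Real.exp_le_exp.2 ?_)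
      refine mul_le_of_le_one_right (by positivity) ?_
      rw [norm_sub_rev, ← dist_eq_norm]
      exact (Metric.mem_ball.1 hθ).le
    · refine (norm_sum_le_of_le _ fun t _ => (norm_gradient_eq _ θ) ▸ hD (τ t) θ).trans ?_
      simp
  · refine Eventually.of_forall fun τ θ _ => ?_
    exact (h.hasFDerivAt_weight M θ₀ θ τ).mul_const _

end TrajLaw

/-! ### Sample means -/

section SampleMean

variable {T : Type*} [MeasurableSpace T] (p : Measure T) [IsProbabilityMeasure p]

lemma integral_inner_eval_of_ne {n : ℕ} {f : T → Param d} (hf : Measurable f)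
    (hfi : Integrable f p) {i j : Fin n}
    (hij : i ≠ j) :
    ∫ τ, inner ℝ (f (τ i)) (f (τ j)) ∂(Measure.pi fun _ : Fin n => p) =
      inner ℝ (∫ t, f t ∂p) (∫ t, f t ∂p) := by
  have hind := (iIndepFun_pi (μ := fun _ : Fin n => p) (X := fun _ => f)
    fun _ => hf.aemeasurable).indepFun hij
  have hm : ∀ i, Integrable (fun τ : Fin n → T => f (τ i)) (Measure.pi fun _ : Fin n => p) :=
    fun i => integrable_comp_eval (μ := fun _ : Fin n => p) (i := i) hfi
  have he : ∀ i, ∫ τ, f (τ i) ∂(Measure.pi fun _ : Fin n => p) = ∫ t, f t ∂p := fun i =>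
    integral_comp_eval (μ := fun _ : Fin n => p) (i := i) hf.aestronglyMeasurable
  have := hind.integral_bilin (hm i) (hm j) (innerSL ℝ)
  rw [he, he] at this
  exact this

variable {p} in
lemma integrable_sq_norm_of_bdd {n : ℕ} {F : (Fin n → T) → Param d} (hF : Measurable F) {C : ℝ}
    (hC : ∀ τ, ‖F τ‖ ≤ C) : Integrable (fun τ => ‖F τ‖ ^ 2) (Measure.pi fun _ : Fin n => p) :=
  Integrable.of_bound (C := C ^ 2) (hF.norm.pow_const 2).aestronglyMeasurable
    (Eventually.of_forall fun τ => by
      rw [norm_pow, norm_norm]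
      exact pow_le_pow_left₀ (norm_nonneg _) (hC τ) 2)

/-- Bias-variance decomposition of the sample mean of a bounded random vector. -/
lemma integral_norm_sq_mean_add {n : ℕ} (hn : 0 < n) {f : T → Param d} (hf : Measurable f)
    {C : ℝ} (hC : ∀ t, ‖f t‖ ≤ C) (u : Param d) :
    ∫ τ, ‖(n : ℝ)⁻¹ • (∑ i, f (τ i)) + u‖ ^ 2 ∂(Measure.pi fun _ : Fin n => p) =
      ‖(∫ t, f t ∂p) + u‖ ^ 2 + (n : ℝ)⁻¹ * ∫ t, ‖f t - ∫ t, f t ∂p‖ ^ 2 ∂p := by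
  have hn0 : (n : ℝ) ≠ 0 := by positivity
  set c := ∫ t, f t ∂p with hc
  set q := Measure.pi fun _ : Fin n => p with hq
  set X : T → Param d := fun t => f t - c with hX
  have hXm : Measurable X := hf.sub_const c
  have hXb : ∀ t, ‖X t‖ ≤ C + ‖c‖ := fun t => (norm_sub_le _ _).trans (by gcongr; exact hC t)
  have hXint : ∫ t, X t ∂p = 0 := by
    rw [hX, integral_sub (Integrable.of_bound hf.aestronglyMeasurable C (Eventually.of_forall hC))
      (integrable_const c)]
    simp [hc]
  -- Expansion around the mean `c + u`: the linear terms integrate to zero by centring, the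
  -- off-diagonal inner products by independence, and `n` equal diagonal terms remain against the
  -- factor `n⁻²`.
  have hpt : ∀ τ : Fin n → T, ‖(n : ℝ)⁻¹ • (∑ i, f (τ i)) + u‖ ^ 2 =
      ‖c + u‖ ^ 2 + 2 * (n : ℝ)⁻¹ * (∑ i, inner ℝ (c + u) (X (τ i))) +
        (n : ℝ)⁻¹ ^ 2 * ∑ i, ∑ j, inner ℝ (X (τ i)) (X (τ j)) := by
    intro τ
    have : (n : ℝ)⁻¹ • (∑ i, f (τ i)) + u = (c + u) + (n : ℝ)⁻¹ • ∑ i, X (τ i) := by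
      simp only [hX, Finset.sum_sub_distrib, Finset.sum_const, Finset.card_univ, Fintype.card_fin,
        smul_sub]
      rw [← Nat.cast_smul_eq_nsmul ℝ, smul_smul, inv_mul_cancel₀ hn0]
      module
    rw [this, norm_add_sq_real, norm_smul, mul_pow, ← real_inner_self_eq_norm_sq (∑ i, X (τ i)),
      sum_inner, inner_smul_right, inner_sum, Real.norm_eq_abs, sq_abs]
    simp only [inner_sum]
    ring
  have hXi : ∀ i : Fin n, Measurable fun τ : Fin n → T => X (τ i) := fun i =>
    hXm.comp (measurable_pi_apply i)
  have hi1 : ∀ i : Fin n, Integrable (fun τ : Fin n → T => inner ℝ (c + u) (X (τ i))) q :=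
    fun i => Integrable.of_bound (C := ‖c + u‖ * (C + ‖c‖))
      (measurable_const.inner (hXi i)).aestronglyMeasurable
      (Eventually.of_forall fun τ => (norm_inner_le_norm _ _).trans (by gcongr; exact hXb _))
  have hi2 : ∀ i j : Fin n, Integrable (fun τ : Fin n → T => inner ℝ (X (τ i)) (X (τ j))) q :=
    fun i j => Integrable.of_bound (C := (C + ‖c‖) * (C + ‖c‖))
      ((hXi i).inner (hXi j)).aestronglyMeasurable
      (Eventually.of_forall fun τ => (norm_inner_le_norm _ _).trans
        (mul_le_mul (hXb _) (hXb _) (norm_nonneg _) ((norm_nonneg _).trans (hXb (τ i)))))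
  have hz : ∀ i : Fin n, ∫ τ, inner ℝ (c + u) (X (τ i)) ∂q = 0 := by
    intro i
    have hXe : ∫ τ, X (τ i) ∂q = ∫ t, X t ∂p :=
      integral_comp_eval (μ := fun _ : Fin n => p) (i := i) hXm.aestronglyMeasurable
    have hXii : Integrable (fun τ : Fin n → T => X (τ i)) q :=
      Integrable.of_bound (hXi i).aestronglyMeasurable _ (Eventually.of_forall fun τ => hXb (τ i))
    rw [integral_inner hXii, hXe, hXint, inner_zero_right]
  have hd : ∀ i j : Fin n, ∫ τ, inner ℝ (X (τ i)) (X (τ j)) ∂q =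
      if i = j then ∫ t, ‖X t‖ ^ 2 ∂p else 0 := by
    intro i j
    split_ifs with hij
    · subst hij
      simp only [real_inner_self_eq_norm_sq]
      exact integral_comp_eval (μ := fun _ : Fin n => p) (i := i)
        (f := fun t => ‖X t‖ ^ 2) (hXm.norm.pow_const 2).aestronglyMeasurable
    · rw [integral_inner_eval_of_ne p hXm
        (Integrable.of_bound hXm.aestronglyMeasurable _ (Eventually.of_forall hXb)) hij, hXint, inner_zero_left]
  simp only [hpt]
  have hs1 : Integrable (fun τ => 2 * (n : ℝ)⁻¹ * ∑ i, inner ℝ (c + u) (X (τ i))) q :=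
    (integrable_finsetSum _ fun i _ => hi1 i).const_mul _
  have hs2 : Integrable (fun τ => (n : ℝ)⁻¹ ^ 2 * ∑ i, ∑ j, inner ℝ (X (τ i)) (X (τ j))) q :=
    (integrable_finsetSum _ fun i _ => integrable_finsetSum _ fun j _ => hi2 i j).const_mul _
  have hs0 : Integrable
      (fun τ => ‖c + u‖ ^ 2 + 2 * (n : ℝ)⁻¹ * ∑ i, inner ℝ (c + u) (X (τ i))) q :=
    (integrable_const _).add hs1
  rw [integral_add hs0 hs2,
    integral_add (integrable_const _) hs1, integral_const_mul, integral_const_mul,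
    integral_finsetSum _ fun i _ => hi1 i,
    integral_finsetSum _ fun i _ => integrable_finsetSum _ fun j _ => hi2 i j]
  simp only [hz, integral_finsetSum _ fun j _ => hi2 _ j, hd]
  simp
  field_simp
  rfl

end SampleMean

/-! ### One step of the algorithm -/

/-- Inputs of the algorithm with the step size, the outer batch constant and the relation between
epoch length and inner batch size that the convergence analysis needs. -/
structure Input.IsTuned (I : Input) (L Q σ : ℝ) : Prop where
  η_eq : I.η = 1 / (2 * L)
  ε_pos : 0 < I.ε
  σ_eq : I.σ = σ
  σ_pos : 0 < σ
  α_eq : I.α = 48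
  β_nonneg : 0 ≤ I.β
  β_le : I.β ≤ 6
  m_pos : 0 < I.m
  B_pos : 0 < I.B
  m_le : I.m = 1 ∨ Q * (I.m : ℝ) ^ 2 ≤ L ^ 2 * I.B

section Step

variable {M : MDP S A} {π : Policy S A d} {g : Param d → M.Traj → Param d} {I : Input}
  {θ₀ : Param d} {L Lg Γ a σ : ℝ}

lemma Input.IsTuned.denominator_pos {Q : ℝ} (hI : I.IsTuned L Q σ) (v : ℕ → Param d) (n : ℕ) :
    0 < I.β / I.m * (∑ i ∈ Finset.Ico (n - I.m) n, ‖v i‖ ^ 2) + I.ε :=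
  add_pos_of_nonneg_of_pos (mul_nonneg (div_nonneg hI.β_nonneg (Nat.cast_nonneg _))
    (Finset.sum_nonneg fun i _ => by positivity)) hI.ε_pos

lemma Input.IsTuned.batchReal_pos {Q : ℝ} (hI : I.IsTuned L Q σ) (v : ℕ → Param d) (n : ℕ) :
    0 < batchReal I v n := by
  have h1 := hI.denominator_pos v n
  have h2 := hI.σ_pos
  rw [batchReal, hI.α_eq, hI.σ_eq]
  positivity

lemma Input.IsTuned.batch_pos {Q : ℝ} (hI : I.IsTuned L Q σ) (v : ℕ → Param d) (n : ℕ) :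
    0 < batch I v n :=
  Nat.ceil_pos.2 (hI.batchReal_pos v n)

/-- Rounding the batch up only lowers the variance, and `σ²` divided by the unrounded batch is the
denominator of that batch over `α = 48`. -/
lemma Input.IsTuned.variance_div_batch_le {Q : ℝ} (hI : I.IsTuned L Q σ) (v : ℕ → Param d)
    (n : ℕ) : (batch I v n : ℝ)⁻¹ * σ ^ 2 ≤
      (I.β / I.m * (∑ i ∈ Finset.Ico (n - I.m) n, ‖v i‖ ^ 2) + I.ε) / 48 := by
  have h1 := hI.denominator_pos v n
  have h2 := hI.σ_pos
  have h3 := hI.batchReal_pos v n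
  have h4 : (batch I v n : ℝ)⁻¹ ≤ (batchReal I v n)⁻¹ := inv_anti₀ h3 (Nat.le_ceil _)
  refine (mul_le_mul_of_nonneg_right h4 (sq_nonneg σ)).trans (le_of_eq ?_)
  rw [batchReal, hI.α_eq, hI.σ_eq]
  field_simp

/-- The bounds on the trajectory gradient and on the importance weights among the `Constants`. -/
structure EstimatorBounds (M : MDP S A) (π : Policy S A d) (g : Param d → M.Traj → Param d)
    (Lg Γ a : ℝ) : Prop where
  Γ_nonneg : 0 ≤ Γ
  lip_g : ∀ τ θ₁ θ₂, ‖g θ₁ τ - g θ₂ τ‖ ≤ Lg * ‖θ₁ - θ₂‖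
  bdd_g : ∀ τ θ, ‖g θ τ‖ ^ 2 ≤ Γ
  weight_le : ∀ θ₁ θ₂,
    ∫ τ, (1 - weight M π θ₁ θ₂ τ) ^ 2 ∂(trajLaw M π θ₁) ≤ a * ‖θ₁ - θ₂‖ ^ 2

lemma Constants.estimatorBounds (hC : Constants M π g L Lg Γ a) :
    EstimatorBounds M π g Lg Γ a :=
  ⟨hC.Γ_pos.le, hC.lip_g, hC.bdd_g, hC.weight_le⟩

lemma EstimatorBounds.norm_le_sqrt (hC : EstimatorBounds M π g Lg Γ a) (θ : Param d) (τ : M.Traj) :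
    ‖g θ τ‖ ≤ √Γ :=
  Real.le_sqrt_of_sq_le (hC.bdd_g τ θ)

lemma Constants.continuous_gradient (hC : Constants M π g L Lg Γ a) :
    Continuous (gradient (objective M π)) :=
  (LipschitzWith.of_dist_le_mul (K := L.toNNReal) fun x y => by
    rw [dist_eq_norm, dist_eq_norm, Real.coe_toNNReal _ hC.L_pos.le]
    exact hC.lip_J x y).continuous

lemma Constants.continuous_g (hC : Constants M π g L Lg Γ a) (τ : M.Traj) :
    Continuous fun θ => g θ τ :=
  (LipschitzWith.of_dist_le_mul (K := Lg.toNNReal) fun x y => by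
    rw [dist_eq_norm, dist_eq_norm, Real.coe_toNNReal _ hC.Lg_nonneg]
    exact hC.lip_g τ x y).continuous

lemma Constants.measurable_uncurry_g (hC : Constants M π g L Lg Γ a)
    (hg : ∀ θ, Measurable (g θ)) : Measurable fun q : Param d × M.Traj => g q.1 q.2 :=
  measurable_uncurry_of_continuous_of_measurable hC.continuous_g hg

lemma Constants.norm_gradient_sq_le (hC : Constants M π g L Lg Γ a) (hu : Unbiased M π g)
    (θ : Param d) : ‖gradient (objective M π) θ‖ ^ 2 ≤ Γ := by
  have h1 := norm_integral_le_of_norm_le_const (μ := trajLaw M π θ)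
    (Eventually.of_forall (hC.estimatorBounds.norm_le_sqrt θ))
  rw [(hu θ).2] at h1
  have h2 : ‖gradient (objective M π) θ‖ ≤ √Γ := by simpa using h1
  exact (pow_le_pow_left₀ (norm_nonneg _) h2 2).trans_eq (Real.sq_sqrt hC.Γ_pos.le)

/-- The semi-stochastic gradient difference used in the inner iterations. -/
def gradDiff (M : MDP S A) (π : Policy S A d) (g : Param d → M.Traj → Param d) (θ θs : Param d)
    (τ : M.Traj) : Param d :=
  g θ τ - weight M π θ θs τ • g θs τ

lemma measurable_gradDiff (hg : ∀ θ, Measurable (g θ)) (θ θs : Param d) :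
    Measurable (gradDiff M π g θ θs) :=
  (hg θ).sub ((measurable_weight M π θ θs).smul (hg θs))

lemma EstimatorBounds.exists_gradDiff_bound (hC : EstimatorBounds M π g Lg Γ a) (h : SmoothPolicy π)
    (θ θs : Param d) : ∃ C, ∀ τ, ‖gradDiff M π g θ θs τ‖ ≤ C := by
  obtain ⟨W, hW⟩ := h.exists_weight_bound M θ θs
  refine ⟨√Γ + W * √Γ, fun τ => (norm_sub_le _ _).trans (add_le_add (hC.norm_le_sqrt θ τ) ?_)⟩
  rw [norm_smul]
  exact mul_le_mul (hW τ) (hC.norm_le_sqrt θs τ) (norm_nonneg _) ((abs_nonneg _).trans (hW τ))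

/-- Trajectories come from `θ`, but the weight turns the mean of `g θs` into its mean under `θs`,
which is `∇J(θs)` by unbiasedness. -/
lemma EstimatorBounds.integral_gradDiff (hC : EstimatorBounds M π g Lg Γ a) (hg : ∀ θ, Measurable (g θ))
    (hu : Unbiased M π g) (h : SmoothPolicy π) (θ θs : Param d) :
    ∫ τ, gradDiff M π g θ θs τ ∂(trajLaw M π θ) =
      gradient (objective M π) θ - gradient (objective M π) θs := by
  obtain ⟨C, hCb⟩ := hC.exists_gradDiff_bound h θ θs
  have hi : Integrable (gradDiff M π g θ θs) (trajLaw M π θ) :=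
    Integrable.of_bound (measurable_gradDiff hg θ θs).aestronglyMeasurable C
      (Eventually.of_forall hCb)
  have hi' : Integrable (fun τ => weight M π θ θs τ • g θs τ) (trajLaw M π θ) := by
    have := (hu θ).1.sub hi
    refine this.congr (Eventually.of_forall fun τ => ?_)
    simp [gradDiff]
  simp only [gradDiff]
  rw [integral_sub (hu θ).1 hi', (hu θ).2, ← h.integral_trajLaw_eq M θ θs, (hu θs).2]

lemma integral_norm_sub_mean_sq {T : Type*} [MeasurableSpace T] (p : Measure T)
    [IsProbabilityMeasure p] {f : T → Param d} (hf : Measurable f) {C : ℝ}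
    (hC : ∀ t, ‖f t‖ ≤ C) :
    ∫ t, ‖f t - ∫ t, f t ∂p‖ ^ 2 ∂p = ∫ t, ‖f t‖ ^ 2 ∂p - ‖∫ t, f t ∂p‖ ^ 2 := by
  have hfi : Integrable f p :=
    Integrable.of_bound hf.aestronglyMeasurable C (Eventually.of_forall hC)
  set c := ∫ t, f t ∂p with hc
  have hsq : Integrable (fun t => ‖f t‖ ^ 2) p :=
    Integrable.of_bound (hf.norm.pow_const 2).aestronglyMeasurable (C ^ 2)
      (Eventually.of_forall fun t => by
        rw [norm_pow, norm_norm]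
        exact pow_le_pow_left₀ (norm_nonneg _) (hC t) 2)
  have hin : Integrable (fun t => 2 * inner ℝ c (f t)) p := (hfi.const_inner c).const_mul 2
  have hd : Integrable (fun t => ‖f t‖ ^ 2 - 2 * inner ℝ c (f t)) p := hsq.sub hin
  simp only [norm_sub_sq_real, real_inner_comm c]
  rw [integral_add hd (integrable_const _), integral_sub hsq hin, integral_const_mul,
    integral_inner hfi]
  simp only [← hc, real_inner_self_eq_norm_sq]
  simp
  ring

lemma EstimatorBounds.integral_gradDiff_sq_le (hC : EstimatorBounds M π g Lg Γ a)
    (h : SmoothPolicy π) (θ θs : Param d) :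
    ∫ τ, ‖gradDiff M π g θ θs τ‖ ^ 2 ∂(trajLaw M π θ) ≤ msConst Lg Γ a * ‖θ - θs‖ ^ 2 := by
  obtain ⟨W, hW⟩ := h.exists_weight_bound M θ θs
  have hwi : Integrable (fun τ => (1 - weight M π θ θs τ) ^ 2) (trajLaw M π θ) := by
    refine Integrable.of_bound
      ((measurable_const.sub (measurable_weight M π θ θs)).pow_const 2).aestronglyMeasurable
      ((1 + W) ^ 2) (Eventually.of_forall fun τ => ?_)
    rw [norm_pow]
    refine pow_le_pow_left₀ (norm_nonneg _) ((norm_sub_le _ _).trans ?_) 2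
    simpa using hW τ
  have hpt : ∀ τ, ‖gradDiff M π g θ θs τ‖ ^ 2 ≤
      2 * Lg ^ 2 * ‖θ - θs‖ ^ 2 + 2 * Γ * (1 - weight M π θ θs τ) ^ 2 := by
    intro τ
    -- The first summand is controlled by the Lipschitz bound on `g`, the second by `Γ` and the
    -- second moment of `1 - ω`. The factor `2` in `Q` comes from squaring a sum of two terms.
    have h0 : gradDiff M π g θ θs τ =
        (g θ τ - g θs τ) + (1 - weight M π θ θs τ) • g θs τ := by
      rw [gradDiff]; module
    have h1 : ‖gradDiff M π g θ θs τ‖ ≤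
        ‖g θ τ - g θs τ‖ + |1 - weight M π θ θs τ| * ‖g θs τ‖ := by
      rw [h0]
      exact (norm_add_le _ _).trans_eq (by rw [norm_smul, Real.norm_eq_abs])
    have h2 : ‖g θ τ - g θs τ‖ ^ 2 ≤ Lg ^ 2 * ‖θ - θs‖ ^ 2 := by
      rw [← mul_pow]
      exact pow_le_pow_left₀ (norm_nonneg _) (hC.lip_g τ θ θs) 2
    have h3 : (|1 - weight M π θ θs τ| * ‖g θs τ‖) ^ 2 ≤ Γ * (1 - weight M π θ θs τ) ^ 2 := by
      rw [mul_pow, sq_abs, mul_comm]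
      exact mul_le_mul_of_nonneg_right (hC.bdd_g τ θs) (sq_nonneg _)
    have h4 := pow_le_pow_left₀ (norm_nonneg _) h1 2
    have h5 := add_sq_le (a := ‖g θ τ - g θs τ‖) (b := |1 - weight M π θ θs τ| * ‖g θs τ‖)
    linarith
  have hm := integral_mono_of_nonneg (μ := trajLaw M π θ) (Eventually.of_forall fun τ => by positivity)
    ((integrable_const _).add (hwi.const_mul (2 * Γ))) (Eventually.of_forall hpt)
  refine hm.trans ?_
  simp only [Pi.add_apply]
  rw [integral_add (integrable_const _) (hwi.const_mul _), integral_const_mul (2 * Γ)]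
  have := mul_le_mul_of_nonneg_left (hC.weight_le θ θs) (by linarith [hC.Γ_nonneg] : 0 ≤ 2 * Γ)
  simp only [integral_const, probReal_univ, one_smul, msConst]
  linarith

/-- Bound for the conditional second moment of the estimation error in step `k`. -/
def errorBound (M : MDP S A) (π : Policy S A d) (I : Input) (θ₀ : Param d) (Q σ : ℝ) (k : ℕ)
    (v : ℕ → Param d) : ℝ :=
  if k % I.m = 0 then (batch I v k : ℝ)⁻¹ * σ ^ 2
  else ‖v (epochStart I k) - gradient (objective M π) (iterate I θ₀ v (epochStart I k))‖ ^ 2 +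
    (I.B : ℝ)⁻¹ * (Q * ‖iterate I θ₀ v k - iterate I θ₀ v (epochStart I k)‖ ^ 2)

/-- The bias-variance identity in terms of the lower integral, which can be iterated along the run
before any integrability is known. -/
lemma lintegral_map_mean_le {T : Type*} [MeasurableSpace T] (p : Measure T)
    [IsProbabilityMeasure p] {n : ℕ} (hn : 0 < n) {f : T → Param d} (hf : Measurable f) {C : ℝ}
    (hC : ∀ t, ‖f t‖ ≤ C) (u w : Param d) :
    ∫⁻ x, ENNReal.ofReal (‖x - w‖ ^ 2) ∂((Measure.pi fun _ : Fin n => p).map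
      fun τ => (n : ℝ)⁻¹ • (∑ i, f (τ i)) + u) =
      ENNReal.ofReal (‖(∫ t, f t ∂p) + u - w‖ ^ 2 +
        (n : ℝ)⁻¹ * ∫ t, ‖f t - ∫ t, f t ∂p‖ ^ 2 ∂p) := by
  have hs : Measurable fun τ : Fin n → T => (n : ℝ)⁻¹ • ∑ i, f (τ i) :=
    (Finset.measurable_sum (f := fun i (τ : Fin n → T) => f (τ i)) _
      fun i _ => hf.comp (measurable_pi_apply i)).const_smul (n : ℝ)⁻¹
  have hmean := integral_norm_sq_mean_add p hn hf hC (u - w)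
  simp only [← add_sub_assoc] at hmean
  rw [lintegral_map (by fun_prop) (hs.add_const u), ← hmean, ofReal_integral_eq_lintegral_ofReal]
  · refine integrable_sq_norm_of_bdd ((hs.add_const u).sub_const w)
      (C := (n : ℝ)⁻¹ * (n * C) + ‖u‖ + ‖w‖) fun τ => ?_
    refine (norm_sub_le _ _).trans (add_le_add_left ((norm_add_le _ _).trans
      (add_le_add_left ?_ _)) _)
    rw [norm_smul, norm_inv, Real.norm_natCast]
    gcongr
    exact (norm_sum_le_of_le _ fun i _ => hC (τ i)).trans_eq (by simp)
  · exact Eventually.of_forall fun τ => by positivity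

lemma lintegral_stepLaw_le (hC : Constants M π g L Lg Γ a) (hg : ∀ θ, Measurable (g θ))
    (hu : Unbiased M π g) (h : SmoothPolicy π) (hv : BoundedVariance M π g σ)
    (hI : I.IsTuned L (msConst Lg Γ a) σ) (k : ℕ) (v : ℕ → Param d) :
    ∫⁻ x, ENNReal.ofReal (‖x - gradient (objective M π) (iterate I θ₀ v k)‖ ^ 2)
        ∂(stepLaw M π g I θ₀ k v) ≤
      ENNReal.ofReal (errorBound M π I θ₀ (msConst Lg Γ a) σ k v) := by
  unfold stepLaw errorBound
  simp only
  split_ifs with hk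
  · have := lintegral_map_mean_le (trajLaw M π (iterate I θ₀ v k)) (hI.batch_pos v k)
      (hg (iterate I θ₀ v k)) (hC.estimatorBounds.norm_le_sqrt _) 0 (gradient (objective M π) (iterate I θ₀ v k))
    simp only [add_zero] at this
    rw [this, (hu _).2, sub_self]
    refine ENNReal.ofReal_le_ofReal ?_
    simp only [norm_zero, ne_eq, OfNat.ofNat_ne_zero, not_false_eq_true, zero_pow, zero_add]
    exact mul_le_mul_of_nonneg_left (hv _).2 (by positivity)
  · set θ := iterate I θ₀ v k
    set θs := iterate I θ₀ v (epochStart I k)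
    obtain ⟨C, hCb⟩ := hC.estimatorBounds.exists_gradDiff_bound h θ θs
    refine (lintegral_map_mean_le (trajLaw M π θ) hI.B_pos (measurable_gradDiff hg θ θs) hCb
      (v (epochStart I k)) (gradient (objective M π) θ)).trans_le (ENNReal.ofReal_le_ofReal ?_)
    -- The mean of the inner estimator minus `∇J(θ)` is `v_{n_k} - ∇J(θs)`, so the bias is the error
    -- of the epoch start. The variance is bounded by the second moment.
    refine add_le_add (le_of_eq ?_) (mul_le_mul_of_nonneg_left
      (((integral_norm_sub_mean_sq _ (measurable_gradDiff hg θ θs) hCb).trans_le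
        (sub_le_self _ (sq_nonneg _))).trans (hC.estimatorBounds.integral_gradDiff_sq_le h θ θs)) (by positivity))
    rw [hC.estimatorBounds.integral_gradDiff hg hu h]
    congr 2
    abel

end Step

/-! ### The law of a run -/

lemma measurable_map_of_measurable_uncurry {X T E : Type*} [MeasurableSpace X] [MeasurableSpace T]
    [MeasurableSpace E] {κ : X → Measure T} (hκ : Measurable κ)
    [hp : ∀ x, IsProbabilityMeasure (κ x)] {F : X → T → E}
    (hF : Measurable fun q : X × T => F q.1 q.2) : Measurable fun x => (κ x).map (F x) := by
  refine Measure.measurable_of_measurable_coe _ fun s hs => ?_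
  let κ' : Kernel X T := ⟨κ, hκ⟩
  have : IsMarkovKernel κ' := ⟨hp⟩
  have hx : ∀ x, (κ x).map (F x) s = κ' x (Prod.mk x ⁻¹' ((fun q : X × T => F q.1 q.2) ⁻¹' s)) :=
    fun x => Measure.map_apply (hF.comp measurable_prodMk_left) hs
  simp only [hx]
  exact Kernel.measurable_kernel_prodMk_left (hF hs)

/-- It suffices to test on boxes, a generating π-system, where the product measure is a finite
product of measurable functions. -/
lemma measurable_pi_of_measurable {X T : Type*} [MeasurableSpace X] [MeasurableSpace T]
    {κ : X → Measure T} (hκ : Measurable κ) [hp : ∀ x, IsProbabilityMeasure (κ x)] (n : ℕ) :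
    Measurable fun x => Measure.pi fun _ : Fin n => κ x := by
  refine Measurable.measure_of_isPiSystem_of_isProbabilityMeasure generateFrom_pi.symm
    isPiSystem_pi ?_
  rintro _ ⟨s, hs, rfl⟩
  simp only [Measure.pi_pi]
  exact Finset.measurable_prod _ fun i _ => (Measure.measurable_coe (hs i (Set.mem_univ i))).comp hκ

section Run

variable {M : MDP S A} {π : Policy S A d} {g : Param d → M.Traj → Param d} {I : Input}
  {θ₀ : Param d} {L Lg Γ a σ : ℝ}

lemma measurable_iterate (I : Input) (θ₀ : Param d) (k : ℕ) :
    Measurable fun v : ℕ → Param d => iterate I θ₀ v k := by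
  unfold iterate
  fun_prop

lemma measurable_batchReal (I : Input) (n : ℕ) :
    Measurable fun v : ℕ → Param d => batchReal I v n := by
  unfold batchReal
  fun_prop

lemma measurable_batch (I : Input) (n : ℕ) : Measurable fun v : ℕ → Param d => batch I v n :=
  Nat.measurable_ceil.comp (measurable_batchReal I n)

lemma measurable_update_param (k : ℕ) :
    Measurable fun q : (ℕ → Param d) × Param d => Function.update q.1 k q.2 := by
  refine measurable_pi_lambda _ fun i => ?_
  by_cases hi : i = k
  · subst hi
    simpa using measurable_snd
  · simpa [hi, Function.comp_def] using (measurable_pi_apply i).comp measurable_fst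

lemma measurable_sampleMean {X T : Type*} [MeasurableSpace X] [MeasurableSpace T] {n : ℕ}
    {F : X → T → Param d} (hF : Measurable fun q : X × T => F q.1 q.2) :
    Measurable fun q : X × (Fin n → T) => (n : ℝ)⁻¹ • ∑ i, F q.1 (q.2 i) :=
  (Finset.measurable_sum (f := fun i (q : X × (Fin n → T)) => F q.1 (q.2 i)) _ fun i _ =>
    hF.comp (measurable_fst.prodMk ((measurable_pi_apply i).comp measurable_snd))).const_smul
      (n : ℝ)⁻¹

lemma measurable_stepLaw (hC : Constants M π g L Lg Γ a) (hg : ∀ θ, Measurable (g θ))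
    (h : SmoothPolicy π) (k : ℕ) : Measurable (stepLaw M π g I θ₀ k) := by
  have hit := measurable_iterate I θ₀ k
  have hits := measurable_iterate I θ₀ (epochStart I k)
  have hgm := hC.measurable_uncurry_g hg
  have hgj : ∀ j, Measurable fun q : (ℕ → Param d) × M.Traj => g (iterate I θ₀ q.1 j) q.2 :=
    fun j => hgm.comp (((measurable_iterate I θ₀ j).comp measurable_fst).prodMk measurable_snd)
  have hlaw : ∀ n, Measurable fun v : ℕ → Param d =>
      Measure.pi fun _ : Fin n => trajLaw M π (iterate I θ₀ v k) := fun n =>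
    measurable_pi_of_measurable
      (κ := fun v => trajLaw M π (iterate I θ₀ v k)) ((h.measurable_trajLaw M).comp hit) n
  unfold stepLaw
  by_cases hk : k % I.m = 0
  · simp only [hk, if_true]
    -- The batch size, and with it the sample space, depends on the past. Treating it as a separate
    -- countable coordinate reduces measurability to fixed sizes.
    have hjoint : Measurable fun q : ℕ × (ℕ → Param d) =>
        (Measure.pi fun _ : Fin q.1 => trajLaw M π (iterate I θ₀ q.2 k)).map
          fun τ => (q.1 : ℝ)⁻¹ • ∑ i, g (iterate I θ₀ q.2 k) (τ i) :=
      measurable_from_prod_countable_right fun n =>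
        measurable_map_of_measurable_uncurry (hlaw n)
          (F := fun v τ => (n : ℝ)⁻¹ • ∑ i, g (iterate I θ₀ v k) (τ i))
          (measurable_sampleMean (F := fun v τ => g (iterate I θ₀ v k) τ) (hgj k))
    exact hjoint.comp ((measurable_batch I k).prodMk measurable_id)
  · simp only [hk, if_false]
    refine measurable_map_of_measurable_uncurry (hlaw I.B)
      (F := fun v τ => (I.B : ℝ)⁻¹ • (∑ i, gradDiff M π g (iterate I θ₀ v k)
        (iterate I θ₀ v (epochStart I k)) (τ i)) + v (epochStart I k))
      (Measurable.add ?_ ((measurable_pi_apply _).comp measurable_fst))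
    have hw : Measurable fun q : (ℕ → Param d) × M.Traj =>
        weight M π (iterate I θ₀ q.1 k) (iterate I θ₀ q.1 (epochStart I k)) q.2 :=
      (h.measurable_uncurry_weight M).comp
        (((hit.comp measurable_fst).prodMk (hits.comp measurable_fst)).prodMk measurable_snd)
    exact measurable_sampleMean (F := fun v τ => gradDiff M π g (iterate I θ₀ v k)
      (iterate I θ₀ v (epochStart I k)) τ) ((hgj k).sub (hw.smul (hgj (epochStart I k))))

lemma isProbabilityMeasure_stepLaw (hg : ∀ θ, Measurable (g θ)) (k : ℕ) (v : ℕ → Param d) :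
    IsProbabilityMeasure (stepLaw M π g I θ₀ k v) := by
  have hsum : ∀ (n : ℕ) {f : M.Traj → Param d}, Measurable f →
      Measurable fun τ : Fin n → M.Traj => (n : ℝ)⁻¹ • ∑ i, f (τ i) := fun n f hf =>
    (measurable_sampleMean (X := Unit) (F := fun _ => f) (hf.comp measurable_snd)).comp
      (measurable_const.prodMk measurable_id : Measurable fun τ => ((), τ))
  unfold stepLaw
  simp only
  split_ifs
  · exact Measure.isProbabilityMeasure_map (hsum _ (hg _)).aemeasurable
  · exact Measure.isProbabilityMeasure_map
      ((hsum _ (measurable_gradDiff hg _ _)).add_const _).aemeasurable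

lemma measurable_stepLaw_map_update (hC : Constants M π g L Lg Γ a) (hg : ∀ θ, Measurable (g θ))
    (h : SmoothPolicy π) (k : ℕ) : Measurable fun v : ℕ → Param d =>
      (stepLaw M π g I θ₀ k v).map fun x => Function.update v k x :=
  have := isProbabilityMeasure_stepLaw (I := I) (θ₀ := θ₀) (π := π) hg k
  measurable_map_of_measurable_uncurry (measurable_stepLaw hC hg h k) (measurable_update_param k)

/-- The tower property: integrate over the new direction given the past, then over the past. -/
lemma lintegral_runLaw_succ (hC : Constants M π g L Lg Γ a) (hg : ∀ θ, Measurable (g θ))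
    (h : SmoothPolicy π) (k : ℕ) {f : (ℕ → Param d) → ENNReal} (hf : Measurable f) :
    ∫⁻ v, f v ∂(runLaw M π g I θ₀ (k + 1)) =
      ∫⁻ v, ∫⁻ x, f (Function.update v k x) ∂(stepLaw M π g I θ₀ k v)
        ∂(runLaw M π g I θ₀ k) := by
  rw [runLaw, Measure.lintegral_bind (measurable_stepLaw_map_update hC hg h k).aemeasurable
    hf.aemeasurable]
  refine lintegral_congr fun v => ?_
  exact lintegral_map hf ((measurable_update_param k).comp measurable_prodMk_left)

lemma isProbabilityMeasure_runLaw (hC : Constants M π g L Lg Γ a) (hg : ∀ θ, Measurable (g θ))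
    (h : SmoothPolicy π) (n : ℕ) : IsProbabilityMeasure (runLaw M π g I θ₀ n) := by
  induction n with
  | zero => unfold runLaw; infer_instance
  | succ k ih =>
    refine ⟨?_⟩
    have := lintegral_runLaw_succ (I := I) (θ₀ := θ₀) hC hg h k (f := 1) measurable_one
    have hs := isProbabilityMeasure_stepLaw (I := I) (θ₀ := θ₀) (π := π) hg k
    simpa using this

/-- The law of the directions before iteration `k` is not changed by the later iterations. -/
lemma lintegral_runLaw_of_le (hC : Constants M π g L Lg Γ a) (hg : ∀ θ, Measurable (g θ))
    (h : SmoothPolicy π) {k n : ℕ} (hkn : k ≤ n) {f : (ℕ → Param d) → ENNReal}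
    (hf : Measurable f) (hdep : ∀ v w : ℕ → Param d, (∀ i < k, v i = w i) → f v = f w) :
    ∫⁻ v, f v ∂(runLaw M π g I θ₀ n) = ∫⁻ v, f v ∂(runLaw M π g I θ₀ k) := by
  induction n, hkn using Nat.le_induction with
  | base => rfl
  | succ n hkn ih =>
    rw [← ih, lintegral_runLaw_succ hC hg h n hf]
    refine lintegral_congr fun v => ?_
    have hs := isProbabilityMeasure_stepLaw (I := I) (θ₀ := θ₀) (π := π) hg n v
    have : ∀ x, f (Function.update v n x) = f v := fun x => hdep _ _ fun i hi =>
      Function.update_of_ne (hi.trans_le hkn).ne _ _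
    simp [this]

/-! ### Errors of the directions and their expectations along a run -/

lemma epochStart_le (I : Input) (k : ℕ) : epochStart I k ≤ k := Nat.div_mul_le_self k I.m

lemma epochStart_lt {k : ℕ} (hk : k % I.m ≠ 0) : epochStart I k < k := by
  have := Nat.div_add_mod' k I.m
  unfold epochStart
  omega

lemma iterate_congr {v w : ℕ → Param d} {k : ℕ} (h : ∀ i < k, v i = w i) :
    iterate I θ₀ v k = iterate I θ₀ w k := by
  rw [iterate, iterate, Finset.sum_congr rfl fun i hi => h i (Finset.mem_range.1 hi)]

lemma batch_congr {v w : ℕ → Param d} {k : ℕ} (h : ∀ i < k, v i = w i) :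
    batch I v k = batch I w k := by
  rw [batch, batch, batchReal, batchReal, Finset.sum_congr rfl fun i hi => by
    rw [h i (Finset.mem_Ico.1 hi).2]]

/-- The squared error of the direction of step `k` as an estimate of the gradient. -/
def errorSq (M : MDP S A) (π : Policy S A d) (I : Input) (θ₀ : Param d) (k : ℕ)
    (v : ℕ → Param d) : ℝ :=
  ‖v k - gradient (objective M π) (iterate I θ₀ v k)‖ ^ 2

lemma errorSq_nonneg (k : ℕ) (v : ℕ → Param d) : 0 ≤ errorSq M π I θ₀ k v := sq_nonneg _

lemma errorBound_congr {v w : ℕ → Param d} {k : ℕ} {Q : ℝ} (h : ∀ i < k, v i = w i) :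
    errorBound M π I θ₀ Q σ k v = errorBound M π I θ₀ Q σ k w := by
  unfold errorBound
  split_ifs with hk
  · rw [batch_congr h]
  · rw [iterate_congr h, h _ (epochStart_lt hk),
      iterate_congr fun i hi => h i (hi.trans (epochStart_lt hk))]

lemma Constants.measurable_errorSq (hC : Constants M π g L Lg Γ a) (k : ℕ) :
    Measurable (errorSq M π I θ₀ k) :=
  (((measurable_pi_apply k).sub
    (hC.continuous_gradient.measurable.comp (measurable_iterate I θ₀ k))).norm).pow_const 2

lemma Constants.measurable_errorBound (hC : Constants M π g L Lg Γ a) (Q : ℝ) (k : ℕ) :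
    Measurable (errorBound M π I θ₀ Q σ k) := by
  unfold errorBound
  split_ifs
  · exact ((measurable_from_nat (f := fun n : ℕ => (n : ℝ)⁻¹)).comp
      (measurable_batch I k)).mul_const _
  · exact (hC.measurable_errorSq (epochStart I k)).add
      (((((measurable_iterate I θ₀ k).sub (measurable_iterate I θ₀ _)).norm.pow_const 2).const_mul
        Q).const_mul _)

/-- The error of step `k` depends on the first `k + 1` directions and its bound on the first `k`, so
later steps can be dropped and the one-step estimate applied conditionally. -/
lemma lintegral_errorSq_le (hC : Constants M π g L Lg Γ a) (hg : ∀ θ, Measurable (g θ))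
    (hu : Unbiased M π g) (h : SmoothPolicy π) (hv : BoundedVariance M π g σ)
    (hI : I.IsTuned L (msConst Lg Γ a) σ) {k n : ℕ} (hkn : k < n) :
    ∫⁻ v, ENNReal.ofReal (errorSq M π I θ₀ k v) ∂(runLaw M π g I θ₀ n) ≤
      ∫⁻ v, ENNReal.ofReal (errorBound M π I θ₀ (msConst Lg Γ a) σ k v)
        ∂(runLaw M π g I θ₀ n) := by
  rw [lintegral_runLaw_of_le hC hg h (Nat.succ_le_of_lt hkn)
      (hC.measurable_errorSq k).ennreal_ofReal fun v w hvw => by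
        rw [errorSq, errorSq, hvw k (Nat.lt_succ_self k),
          iterate_congr fun i hi => hvw i (hi.trans (Nat.lt_succ_self k))],
    lintegral_runLaw_of_le hC hg h hkn.le
      (hC.measurable_errorBound (msConst Lg Γ a) k).ennreal_ofReal fun v w hvw => by
        rw [errorBound_congr hvw],
    Nat.succ_eq_add_one, lintegral_runLaw_succ hC hg h k (hC.measurable_errorSq k).ennreal_ofReal]
  refine lintegral_mono fun v => le_trans (le_of_eq (lintegral_congr fun x => ?_))
    (lintegral_stepLaw_le hC hg hu h hv hI k v)
  rw [errorSq, Function.update_self,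
    iterate_congr (w := v) fun i hi => Function.update_of_ne (ne_of_lt hi) _ _]

/-- A bound for `errorBound` that is affine in the squared directions and the squared errors of
earlier steps. -/
def affineErrorBound (M : MDP S A) (π : Policy S A d) (I : Input) (θ₀ : Param d) (Q : ℝ) (k : ℕ)
    (v : ℕ → Param d) : ℝ :=
  if k % I.m = 0 then (I.β / I.m * (∑ i ∈ Finset.Ico (k - I.m) k, ‖v i‖ ^ 2) + I.ε) / 48
  else errorSq M π I θ₀ (epochStart I k) v + (I.B : ℝ)⁻¹ * Q * I.η ^ 2 *
    (k - epochStart I k : ℕ) * ∑ i ∈ Finset.Ico (epochStart I k) k, ‖v i‖ ^ 2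

lemma norm_iterate_sub_sq_le {j k : ℕ} (hjk : j ≤ k) (v : ℕ → Param d) :
    ‖iterate I θ₀ v k - iterate I θ₀ v j‖ ^ 2 ≤
      I.η ^ 2 * ((k - j : ℕ) * ∑ i ∈ Finset.Ico j k, ‖v i‖ ^ 2) := by
  have : iterate I θ₀ v k - iterate I θ₀ v j = I.η • ∑ i ∈ Finset.Ico j k, v i := by
    rw [iterate, iterate, Finset.sum_Ico_eq_sub _ hjk]
    module
  rw [this, norm_smul, mul_pow, Real.norm_eq_abs, sq_abs]
  refine mul_le_mul_of_nonneg_left ?_ (sq_nonneg _)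
  calc ‖∑ i ∈ Finset.Ico j k, v i‖ ^ 2 ≤ (∑ i ∈ Finset.Ico j k, ‖v i‖) ^ 2 :=
        pow_le_pow_left₀ (norm_nonneg _) (norm_sum_le _ _) 2
    _ ≤ _ := by simpa using sq_sum_le_card_mul_sum_sq (s := Finset.Ico j k) (f := fun i => ‖v i‖)

lemma errorBound_le_affineErrorBound {Q : ℝ} (hQ : 0 ≤ Q) (hI : I.IsTuned L Q σ) (k : ℕ)
    (v : ℕ → Param d) :
    errorBound M π I θ₀ Q σ k v ≤ affineErrorBound M π I θ₀ Q k v := by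
  unfold errorBound affineErrorBound
  split_ifs
  · exact hI.variance_div_batch_le v k
  · refine add_le_add le_rfl ?_
    have := mul_le_mul_of_nonneg_left
      (norm_iterate_sub_sq_le (I := I) (θ₀ := θ₀) (epochStart_le I k) v)
      (mul_nonneg (inv_nonneg.2 (Nat.cast_nonneg I.B)) hQ)
    linarith

lemma Constants.msConst_pos (hC : Constants M π g L Lg Γ a) : 0 < msConst Lg Γ a := by
  have := mul_pos hC.Γ_pos hC.a_pos
  unfold msConst
  positivity

lemma norm_sq_le_errorSq (hC : Constants M π g L Lg Γ a) (hu : Unbiased M π g) (k : ℕ)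
    (v : ℕ → Param d) : ‖v k‖ ^ 2 ≤ 2 * errorSq M π I θ₀ k v + 2 * Γ := by
  have h1 : ‖v k‖ ≤ ‖v k - gradient (objective M π) (iterate I θ₀ v k)‖ +
      ‖gradient (objective M π) (iterate I θ₀ v k)‖ := by
    simpa using norm_add_le (v k - gradient (objective M π) (iterate I θ₀ v k))
      (gradient (objective M π) (iterate I θ₀ v k))
  have h2 := pow_le_pow_left₀ (norm_nonneg _) h1 2
  have h3 := hC.norm_gradient_sq_le hu (iterate I θ₀ v k)
  have h4 := add_sq_le (a := ‖v k - gradient (objective M π) (iterate I θ₀ v k)‖)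
    (b := ‖gradient (objective M π) (iterate I θ₀ v k)‖)
  unfold errorSq
  linarith

lemma integrable_affineErrorBound {μ : Measure (ℕ → Param d)} [IsProbabilityMeasure μ] {Q : ℝ}
    {k : ℕ} (hv : ∀ i < k, Integrable (fun v => ‖v i‖ ^ 2) μ)
    (he : ∀ i < k, Integrable (errorSq M π I θ₀ i) μ) :
    Integrable (affineErrorBound M π I θ₀ Q k) μ := by
  unfold affineErrorBound
  split_ifs with hk
  · exact (((integrable_finsetSum _ fun i hi => hv i (Finset.mem_Ico.1 hi).2).const_mul _).add
      (integrable_const _)).div_const _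
  · exact (he _ (epochStart_lt hk)).add
      ((integrable_finsetSum _ fun i hi => hv i (Finset.mem_Ico.1 hi).2).const_mul _)

/-- The affine bound for step `k` involves earlier steps only, so strong induction makes it
integrable, hence the error. Then `‖v_k‖²` is integrable because `∇J` is bounded. -/
lemma integrable_errorSq_and_norm_sq (hC : Constants M π g L Lg Γ a) (hg : ∀ θ, Measurable (g θ))
    (hu : Unbiased M π g) (h : SmoothPolicy π) (hv : BoundedVariance M π g σ)
    (hI : I.IsTuned L (msConst Lg Γ a) σ) {n : ℕ} (k : ℕ) (hkn : k < n) :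
    Integrable (errorSq M π I θ₀ k) (runLaw M π g I θ₀ n) ∧
      Integrable (fun v => ‖v k‖ ^ 2) (runLaw M π g I θ₀ n) := by
  have hprob := isProbabilityMeasure_runLaw (I := I) (θ₀ := θ₀) hC hg h n
  induction k using Nat.strong_induction_on with
  | _ k ih =>
    have hb : Integrable (affineErrorBound M π I θ₀ (msConst Lg Γ a) k)
        (runLaw M π g I θ₀ n) :=
      integrable_affineErrorBound (fun i hi => (ih i hi (hi.trans hkn)).2)
        fun i hi => (ih i hi (hi.trans hkn)).1
    have he : Integrable (errorSq M π I θ₀ k) (runLaw M π g I θ₀ n) := by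
      refine ⟨(hC.measurable_errorSq k).aestronglyMeasurable, ?_⟩
      rw [hasFiniteIntegral_iff_ofReal (Eventually.of_forall (errorSq_nonneg k))]
      refine (lintegral_errorSq_le hC hg hu h hv hI hkn).trans_lt (lt_of_le_of_lt
        (lintegral_mono fun v => ENNReal.ofReal_le_ofReal
          (errorBound_le_affineErrorBound hC.msConst_pos.le hI k v)) ?_)
      exact hb.lintegral_lt_top
    refine ⟨he, ((he.const_mul 2).add (integrable_const (2 * Γ))).mono'
      ((measurable_pi_apply k).norm.pow_const 2).aestronglyMeasurable
      (Eventually.of_forall fun v => ?_)⟩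
    rw [norm_pow, norm_norm]
    exact norm_sq_le_errorSq hC hu k v

lemma integral_errorSq_le (hC : Constants M π g L Lg Γ a) (hg : ∀ θ, Measurable (g θ))
    (hu : Unbiased M π g) (h : SmoothPolicy π) (hv : BoundedVariance M π g σ)
    (hI : I.IsTuned L (msConst Lg Γ a) σ) {k n : ℕ} (hkn : k < n) :
    ∫ v, errorSq M π I θ₀ k v ∂(runLaw M π g I θ₀ n) ≤
      ∫ v, affineErrorBound M π I θ₀ (msConst Lg Γ a) k v ∂(runLaw M π g I θ₀ n) := by
  have hprob := isProbabilityMeasure_runLaw (I := I) (θ₀ := θ₀) hC hg h n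
  have hint := fun i (hi : i < n) =>
    integrable_errorSq_and_norm_sq (θ₀ := θ₀) hC hg hu h hv hI i hi
  have hb : Integrable (affineErrorBound M π I θ₀ (msConst Lg Γ a) k)
      (runLaw M π g I θ₀ n) :=
    integrable_affineErrorBound (fun i hi => (hint i (hi.trans hkn)).2)
      fun i hi => (hint i (hi.trans hkn)).1
  have hle : ∀ v, errorBound M π I θ₀ (msConst Lg Γ a) σ k v ≤
      affineErrorBound M π I θ₀ (msConst Lg Γ a) k v :=
    errorBound_le_affineErrorBound hC.msConst_pos.le hI k
  have h0 : ∀ v, 0 ≤ affineErrorBound M π I θ₀ (msConst Lg Γ a) k v := fun v => by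
    refine le_trans ?_ (hle v)
    have := hC.msConst_pos
    unfold errorBound
    split_ifs <;> positivity
  rw [← ENNReal.ofReal_le_ofReal_iff (integral_nonneg h0),
    ofReal_integral_eq_lintegral_ofReal (hint k hkn).1 (Eventually.of_forall (errorSq_nonneg k)),
    ofReal_integral_eq_lintegral_ofReal hb (Eventually.of_forall h0)]
  exact (lintegral_errorSq_le hC hg hu h hv hI hkn).trans
    (lintegral_mono fun v => ENNReal.ofReal_le_ofReal (hle v))

end Run

/-! ### Accuracy of the output -/

section Accuracy

/-- The ascent inequality for a function with Lipschitz gradient. -/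
lemma add_inner_sub_le_of_lipschitz_gradient {f : Param d → ℝ} (hf : Differentiable ℝ f) {L : ℝ}
    (hL : ∀ x y, ‖gradient f x - gradient f y‖ ≤ L * ‖x - y‖) (x u : Param d) :
    f x + inner ℝ (gradient f x) u - L / 2 * ‖u‖ ^ 2 ≤ f (x + u) := by
  -- `φ` is `f` along the segment minus the linear term plus the quadratic one. The Lipschitz bound
  -- makes `φ' ≥ 0` on `(0, 1)`, and `φ 0 ≤ φ 1` is the claim.
  set φ : ℝ → ℝ := fun t => f (x + t • u) - t * inner ℝ (gradient f x) u +
    L / 2 * t ^ 2 * ‖u‖ ^ 2 with hφ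
  have hder : ∀ t, HasDerivAt φ (inner ℝ (gradient f (x + t • u)) u -
      inner ℝ (gradient f x) u + L * t * ‖u‖ ^ 2) t := by
    intro t
    have h1 : HasDerivAt (fun t : ℝ => x + t • u) u t := by
      simpa using ((hasDerivAt_id t).smul_const u).const_add x
    have h2 := (hf (x + t • u)).hasFDerivAt.comp_hasDerivAt t h1
    rw [fderiv_apply_eq_inner_gradient] at h2
    have h3 := (hasDerivAt_id t).mul_const (inner ℝ (gradient f x) u)
    have h4 := (((hasDerivAt_id t).pow 2).const_mul (L / 2)).mul_const (‖u‖ ^ 2)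
    refine ((h2.sub h3).add h4).congr_deriv ?_
    simp only [id_eq, Nat.cast_ofNat]
    ring
  have hmono : MonotoneOn φ (Set.Icc 0 1) := by
    refine monotoneOn_of_deriv_nonneg (convex_Icc 0 1)
      (fun t _ => (hder t).continuousAt.continuousWithinAt)
      (fun t _ => (hder t).differentiableAt.differentiableWithinAt) fun t ht => ?_
    rw [interior_Icc] at ht
    rw [(hder t).deriv]
    have h1 := abs_real_inner_le_norm (gradient f (x + t • u) - gradient f x) u
    have h2 := hL (x + t • u) x
    rw [add_sub_cancel_left, norm_smul, Real.norm_of_nonneg ht.1.le] at h2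
    have h3 := mul_le_mul_of_nonneg_right h2 (norm_nonneg u)
    rw [← inner_sub_left]
    nlinarith [neg_abs_le (inner ℝ (gradient f (x + t • u) - gradient f x) u)]
  have h01 := hmono (Set.left_mem_Icc.2 zero_le_one) (Set.right_mem_Icc.2 zero_le_one) zero_le_one
  simp only [hφ, zero_smul, add_zero, one_smul] at h01
  linarith

/-! ### Summation of the errors over epochs -/

lemma card_filter_div_eq_le {m : ℕ} (hm : 0 < m) (n q : ℕ) :
    ((Finset.range n).filter fun k => k / m = q).card ≤ m := by
  have hsub : ((Finset.range n).filter fun k => k / m = q) ⊆ Finset.Ico (q * m) (q * m + m) := by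
    intro k hk
    have := (Nat.div_eq_iff hm).1 (Finset.mem_filter.1 hk).2
    rw [Finset.mem_Ico]
    omega
  simpa using Finset.card_le_card hsub

/-- Double counting: `V i` is charged only by steps `k` in epoch `q i`, of which there are at most
`m`. It is used for the current epoch, `q i = i / m`, and for the next one, `q i = i / m + 1`. -/
lemma sum_sum_filter_div_le {m : ℕ} (hm : 0 < m) (n : ℕ) {V : ℕ → ℝ} (hV : ∀ i, 0 ≤ V i)
    (q : ℕ → ℕ) :
    ∑ k ∈ Finset.range n, ∑ i ∈ (Finset.range n).filter (fun i => q i = k / m), V i ≤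
      m * ∑ i ∈ Finset.range n, V i := by
  simp only [Finset.sum_filter]
  rw [Finset.sum_comm, Finset.mul_sum]
  refine Finset.sum_le_sum fun i _ => ?_
  rw [← Finset.sum_filter, Finset.sum_const, nsmul_eq_mul]
  refine mul_le_mul_of_nonneg_right (Nat.cast_le.2 ?_) (hV i)
  simpa only [eq_comm] using card_filter_div_eq_le hm n (q i)

/-- The errors of the directions are controlled by the directions themselves. -/
lemma sum_error_le {m n : ℕ} (hm : 0 < m) {β ε c : ℝ} (hβ0 : 0 ≤ β) (hβ : β ≤ 6)
    (hc0 : 0 ≤ c) (hc : c * (m : ℝ) ^ 2 ≤ 1 / 4) {V E : ℕ → ℝ} (hV : ∀ i, 0 ≤ V i)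
    (houter : ∀ k < n, k % m = 0 →
      E k ≤ (β / m * (∑ i ∈ Finset.Ico (k - m) k, V i) + ε) / 48)
    (hinner : ∀ k < n, k % m ≠ 0 → E k ≤ E (k / m * m) +
      c * (k - k / m * m : ℕ) * ∑ i ∈ Finset.Ico (k / m * m) k, V i) :
    ∑ k ∈ Finset.range n, E k ≤ n * ε / 48 + 3 / 8 * ∑ i ∈ Finset.range n, V i := by
  have hm' : (0 : ℝ) < m := Nat.cast_pos.2 hm
  -- Writing `i / m + 1 = k / m` for the preceding epoch avoids truncated subtraction. In epoch `0`
  -- the interval on the left is empty.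
  have hprev : ∀ k < n, ∑ i ∈ Finset.Ico (k / m * m - m) (k / m * m), V i ≤
      ∑ i ∈ (Finset.range n).filter (fun i => i / m + 1 = k / m), V i := by
    intro k hk
    refine Finset.sum_le_sum_of_subset_of_nonneg (fun i hi => ?_) fun i _ _ => hV i
    rw [Finset.mem_Ico] at hi
    have hkm := Nat.div_mul_le_self k m
    refine Finset.mem_filter.2 ⟨Finset.mem_range.2 (by omega), ?_⟩
    obtain ⟨q, hq⟩ : ∃ q, k / m = q + 1 := by
      refine Nat.exists_eq_succ_of_ne_zero fun h0 => ?_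
      rw [h0] at hi
      omega
    rw [hq, Nat.succ_mul] at hi
    rw [hq, (Nat.div_eq_iff hm).2 (by omega : q * m ≤ i ∧ i ≤ q * m + m - 1)]
  have hcur : ∀ k < n, ∑ i ∈ Finset.Ico (k / m * m) k, V i ≤
      ∑ i ∈ (Finset.range n).filter (fun i => i / m = k / m), V i := by
    intro k hk
    refine Finset.sum_le_sum_of_subset_of_nonneg (fun i hi => ?_) fun i _ _ => hV i
    rw [Finset.mem_Ico] at hi
    have hkm := Nat.div_add_mod' k m
    have hlt := Nat.mod_lt k hm
    refine Finset.mem_filter.2 ⟨Finset.mem_range.2 (by omega), ?_⟩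
    exact (Nat.div_eq_iff hm).2 (by omega)
  -- One bound for outer and inner steps: an inner step replaces `E` at its epoch start by the outer
  -- bound and `k - n_k` by `m`.
  have hE : ∀ k < n, E k ≤
      ε / 48 + β / (48 * m) * ∑ i ∈ (Finset.range n).filter (fun i => i / m + 1 = k / m), V i +
        c * m * ∑ i ∈ (Finset.range n).filter (fun i => i / m = k / m), V i := by
    intro k hk
    have hstart : ∀ j < n, j % m = 0 → j / m = k / m → E j ≤ ε / 48 + β / (48 * m) *
        ∑ i ∈ (Finset.range n).filter (fun i => i / m + 1 = k / m), V i := by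
      intro j hj hj0 hjk
      have h1 := houter j hj hj0
      have h2 := hprev j hj
      rw [Nat.div_mul_cancel (Nat.dvd_of_mod_eq_zero hj0), hjk] at h2
      have h3 := mul_le_mul_of_nonneg_left h2 (div_nonneg hβ0 hm'.le)
      have h4 : β / (48 * m) = β / m / 48 := by rw [div_div, mul_comm]
      rw [h4]
      linarith
    have hnn : 0 ≤ ∑ i ∈ (Finset.range n).filter (fun i => i / m = k / m), V i :=
      Finset.sum_nonneg fun i _ => hV i
    by_cases hk0 : k % m = 0
    · have := hstart k hk hk0 rfl
      have := mul_nonneg (mul_nonneg hc0 hm'.le) hnn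
      linarith
    · have h1 := hinner k hk hk0
      have h2 := hstart (k / m * m) ((Nat.div_mul_le_self k m).trans_lt hk)
        (Nat.mul_mod_left _ _) (Nat.mul_div_cancel _ hm)
      have h3 : (k - k / m * m : ℕ) ≤ (m : ℝ) := by
        have := Nat.div_add_mod' k m
        have := Nat.mod_lt k hm
        exact Nat.cast_le.2 (by omega)
      have h4 := mul_le_mul (mul_le_mul_of_nonneg_left h3 hc0) (hcur k hk)
        (Finset.sum_nonneg fun i _ => hV i) (mul_nonneg hc0 hm'.le)
      linarith
  have hsum := Finset.sum_le_sum fun k hk => hE k (Finset.mem_range.1 hk)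
  simp only [Finset.sum_add_distrib, ← Finset.mul_sum, Finset.sum_const, Finset.card_range,
    nsmul_eq_mul] at hsum
  have hSV : 0 ≤ ∑ i ∈ Finset.range n, V i := Finset.sum_nonneg fun i _ => hV i
  have h1 := mul_le_mul_of_nonneg_left (sum_sum_filter_div_le hm n hV fun i => i / m + 1)
    (by positivity : 0 ≤ β / (48 * m))
  have h2 := mul_le_mul_of_nonneg_left (sum_sum_filter_div_le hm n hV fun i => i / m)
    (mul_nonneg hc0 hm'.le)
  -- This is `β/48 ≤ 1/8`. Together with `c * m² ≤ 1/4` it gives the coefficient `3/8`.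
  have h3 : β / (48 * m) * (m * ∑ i ∈ Finset.range n, V i) ≤
      1 / 8 * ∑ i ∈ Finset.range n, V i := by
    rw [← mul_assoc]
    refine mul_le_mul_of_nonneg_right ?_ hSV
    rw [div_mul_eq_mul_div, mul_div_mul_right _ _ hm'.ne']
    linarith
  have h4 := mul_le_mul_of_nonneg_right hc hSV
  nlinarith

/-! ### Ascent and the averaged squared gradient -/

variable {M : MDP S A} {π : Policy S A d} {g : Param d → M.Traj → Param d} {I : Input}
  {θ₀ : Param d} {L Lg Γ a σ : ℝ}

lemma iterate_succ (I : Input) (θ₀ : Param d) (v : ℕ → Param d) (k : ℕ) :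
    iterate I θ₀ v (k + 1) = iterate I θ₀ v k + I.η • v k := by
  rw [iterate, iterate, Finset.sum_range_succ, smul_add, add_assoc]

/-- Ascent of the objective along a run. -/
lemma sum_gradient_sq_le (hC : Constants M π g L Lg Γ a) (h : SmoothPolicy π)
    (hη : I.η = 1 / (2 * L)) (v : ℕ → Param d) (n : ℕ) :
    ∑ k ∈ Finset.range n, (2 * ‖gradient (objective M π) (iterate I θ₀ v k)‖ ^ 2 + ‖v k‖ ^ 2 -
      2 * errorSq M π I θ₀ k v) ≤ 8 * L * (objective M π (iterate I θ₀ v n) - objective M π θ₀) := by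
  have hL := hC.L_pos
  induction n with
  | zero => simp [iterate]
  | succ k ih =>
    rw [Finset.sum_range_succ]
    have hd := add_inner_sub_le_of_lipschitz_gradient (h.differentiable_objective M) hC.lip_J
      (iterate I θ₀ v k) (I.η • v k)
    rw [← iterate_succ, inner_smul_right, norm_smul, mul_pow, Real.norm_eq_abs, sq_abs, hη] at hd
    -- Polarization: `4⟪∇J, v⟫ - ‖v‖²` becomes `2‖∇J‖² + ‖v‖² - 2E`.
    have he : errorSq M π I θ₀ k v = ‖v k‖ ^ 2 -
        2 * inner ℝ (gradient (objective M π) (iterate I θ₀ v k)) (v k) +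
          ‖gradient (objective M π) (iterate I θ₀ v k)‖ ^ 2 := by
      rw [errorSq, norm_sub_sq_real, real_inner_comm]
    have hd' := mul_le_mul_of_nonneg_left hd (by positivity : 0 ≤ 8 * L)
    have hexp : 8 * L * (objective M π (iterate I θ₀ v k) +
        1 / (2 * L) * inner ℝ (gradient (objective M π) (iterate I θ₀ v k)) (v k) -
          L / 2 * ((1 / (2 * L)) ^ 2 * ‖v k‖ ^ 2)) =
        8 * L * objective M π (iterate I θ₀ v k) +
          4 * inner ℝ (gradient (objective M π) (iterate I θ₀ v k)) (v k) - ‖v k‖ ^ 2 := by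
      field_simp
      ring
    rw [hexp] at hd'
    linarith

lemma integral_affineErrorBound {μ : Measure (ℕ → Param d)} [IsProbabilityMeasure μ] {Q : ℝ}
    {k : ℕ} (hv : ∀ i < k, Integrable (fun v => ‖v i‖ ^ 2) μ)
    (he : ∀ i < k, Integrable (errorSq M π I θ₀ i) μ) :
    ∫ v, affineErrorBound M π I θ₀ Q k v ∂μ =
      if k % I.m = 0 then
        (I.β / I.m * (∑ i ∈ Finset.Ico (k - I.m) k, ∫ v, ‖v i‖ ^ 2 ∂μ) + I.ε) / 48
      else ∫ v, errorSq M π I θ₀ (epochStart I k) v ∂μ + (I.B : ℝ)⁻¹ * Q * I.η ^ 2 *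
        (k - epochStart I k : ℕ) * ∑ i ∈ Finset.Ico (epochStart I k) k, ∫ v, ‖v i‖ ^ 2 ∂μ := by
  have hs : ∀ j, Integrable (fun v : ℕ → Param d => ∑ i ∈ Finset.Ico j k, ‖v i‖ ^ 2) μ :=
    fun j => integrable_finsetSum _ fun i hi => hv i (Finset.mem_Ico.1 hi).2
  have hsi : ∀ j, ∫ v : ℕ → Param d, ∑ i ∈ Finset.Ico j k, ‖v i‖ ^ 2 ∂μ =
      ∑ i ∈ Finset.Ico j k, ∫ v, ‖v i‖ ^ 2 ∂μ :=
    fun j => integral_finsetSum _ fun i hi => hv i (Finset.mem_Ico.1 hi).2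
  unfold affineErrorBound
  split_ifs with hk
  · rw [integral_div, integral_add ((hs _).const_mul _) (integrable_const _), integral_const_mul,
      hsi]
    simp
  · rw [integral_add (he _ (epochStart_lt hk)) ((hs _).const_mul _), integral_const_mul, hsi]

lemma Constants.integrable_gradient_sq (hC : Constants M π g L Lg Γ a) (hu : Unbiased M π g)
    {X : Type*} [MeasurableSpace X] (μ : Measure X) [IsFiniteMeasure μ] {F : X → Param d}
    (hF : Measurable F) : Integrable (fun x => ‖gradient (objective M π) (F x)‖ ^ 2) μ :=
  Integrable.of_bound
    ((hC.continuous_gradient.measurable.comp hF).norm.pow_const 2).aestronglyMeasurable Γ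
    (Eventually.of_forall fun x => by
      rw [norm_pow, norm_norm]
      exact hC.norm_gradient_sq_le hu (F x))

lemma sum_integral_gradient_sq_le (hC : Constants M π g L Lg Γ a) (hg : ∀ θ, Measurable (g θ))
    (hu : Unbiased M π g) (h : SmoothPolicy π) (hv : BoundedVariance M π g σ)
    (hI : I.IsTuned L (msConst Lg Γ a) σ) (n : ℕ) :
    ∑ k ∈ Finset.range n, ∫ v, ‖gradient (objective M π) (iterate I θ₀ v k)‖ ^ 2
        ∂(runLaw M π g I θ₀ n) ≤
      4 * L * ((⨆ θ, objective M π θ) - objective M π θ₀) + n * I.ε / 48 := by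
  have hprob := isProbabilityMeasure_runLaw (I := I) (θ₀ := θ₀) hC hg h n
  set μ := runLaw M π g I θ₀ n with hμ
  have hint := fun i (hi : i < n) =>
    integrable_errorSq_and_norm_sq (θ₀ := θ₀) hC hg hu h hv hI i hi
  have hG : ∀ k, Integrable
      (fun v => ‖gradient (objective M π) (iterate I θ₀ v k)‖ ^ 2) μ := fun k =>
    hC.integrable_gradient_sq hu μ (measurable_iterate I θ₀ k)
  have hL := hC.L_pos
  have hQ := hC.msConst_pos
  have hB : (0 : ℝ) < I.B := Nat.cast_pos.2 hI.B_pos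
  have herr := fun k (hk : k < n) =>
    (integral_errorSq_le (θ₀ := θ₀) hC hg hu h hv hI hk).trans_eq
      (integral_affineErrorBound (fun i hi => (hint i (hi.trans hk)).2)
        fun i hi => (hint i (hi.trans hk)).1)
  have hsumE : ∑ k ∈ Finset.range n, ∫ v, errorSq M π I θ₀ k v ∂μ ≤
      n * I.ε / 48 + 3 / 8 * ∑ k ∈ Finset.range n, ∫ v, ‖v k‖ ^ 2 ∂μ := by
    have houter : ∀ k < n, k % I.m = 0 → ∫ v, errorSq M π I θ₀ k v ∂μ ≤
        (I.β / I.m * (∑ i ∈ Finset.Ico (k - I.m) k, ∫ v, ‖v i‖ ^ 2 ∂μ) + I.ε) / 48 :=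
      fun k hk hk0 => by simpa only [hk0, if_true] using herr k hk
    have hinner : ∀ k < n, k % I.m ≠ 0 → ∫ v, errorSq M π I θ₀ k v ∂μ ≤
        ∫ v, errorSq M π I θ₀ (k / I.m * I.m) v ∂μ + (I.B : ℝ)⁻¹ * msConst Lg Γ a * I.η ^ 2 *
          (k - k / I.m * I.m : ℕ) * ∑ i ∈ Finset.Ico (k / I.m * I.m) k, ∫ v, ‖v i‖ ^ 2 ∂μ :=
      fun k hk hk0 => by simpa only [hk0, if_false, epochStart] using herr k hk
    have hV : ∀ i, 0 ≤ ∫ v : ℕ → Param d, ‖v i‖ ^ 2 ∂μ := fun i =>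
      integral_nonneg fun v => by positivity
    -- For `m = 1` there are no inner steps and `c = 0` is allowed. Otherwise `c = Qη²/B =
    -- Q/(4L²B)`, and the tuning condition is exactly `c * m² ≤ 1/4`.
    rcases hI.m_le with hm1 | hm
    · exact sum_error_le (c := 0) hI.m_pos hI.β_nonneg hI.β_le le_rfl (by simp) hV houter
        fun k _ hk0 => absurd (by rw [hm1, Nat.mod_one]) hk0
    · refine sum_error_le hI.m_pos hI.β_nonneg hI.β_le (by positivity) ?_ hV houter hinner
      rw [hI.η_eq]
      have : (I.B : ℝ)⁻¹ * msConst Lg Γ a * (1 / (2 * L)) ^ 2 * (I.m : ℝ) ^ 2 =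
          (msConst Lg Γ a * (I.m : ℝ) ^ 2) / (L ^ 2 * I.B) / 4 := by
        field_simp
        ring
      rw [this]
      have := (div_le_one (by positivity)).2 hm
      linarith
  have hpt : ∀ v, ∑ k ∈ Finset.range n, (2 * ‖gradient (objective M π) (iterate I θ₀ v k)‖ ^ 2 +
      ‖v k‖ ^ 2 - 2 * errorSq M π I θ₀ k v) ≤
        8 * L * ((⨆ θ, objective M π θ) - objective M π θ₀) := fun v =>
    (sum_gradient_sq_le hC h hI.η_eq v n).trans (mul_le_mul_of_nonneg_left
      (sub_le_sub_right (le_ciSup (bddAbove_objective M π) _) _) (by positivity))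
  have hint1 : ∀ k < n, Integrable (fun v => 2 * ‖gradient (objective M π) (iterate I θ₀ v k)‖ ^ 2 +
      ‖v k‖ ^ 2) μ := fun k hk => ((hG k).const_mul 2).add (hint k hk).2
  have hint2 : ∀ k < n, Integrable (fun v => 2 * ‖gradient (objective M π) (iterate I θ₀ v k)‖ ^ 2 +
      ‖v k‖ ^ 2 - 2 * errorSq M π I θ₀ k v) μ := fun k hk =>
    (hint1 k hk).sub ((hint k hk).1.const_mul 2)
  have hmono := integral_mono (μ := μ)
    (integrable_finsetSum _ fun k hk => hint2 k (Finset.mem_range.1 hk)) (integrable_const _) hpt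
  rw [integral_finsetSum _ fun k hk => hint2 k (Finset.mem_range.1 hk)] at hmono
  have hterm : ∀ k ∈ Finset.range n,
      ∫ v, (2 * ‖gradient (objective M π) (iterate I θ₀ v k)‖ ^ 2 + ‖v k‖ ^ 2 -
        2 * errorSq M π I θ₀ k v) ∂μ =
      2 * ∫ v, ‖gradient (objective M π) (iterate I θ₀ v k)‖ ^ 2 ∂μ + ∫ v, ‖v k‖ ^ 2 ∂μ -
        2 * ∫ v, errorSq M π I θ₀ k v ∂μ := by
    intro k hk
    have hk := Finset.mem_range.1 hk
    rw [integral_sub (hint1 k hk) ((hint k hk).1.const_mul 2),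
      integral_add ((hG k).const_mul 2) (hint k hk).2, integral_const_mul, integral_const_mul]
  rw [Finset.sum_congr rfl hterm, Finset.sum_sub_distrib, Finset.sum_add_distrib,
    ← Finset.mul_sum, ← Finset.mul_sum, integral_const, probReal_univ, one_smul] at hmono
  have hSV : 0 ≤ ∑ k ∈ Finset.range n, ∫ v : ℕ → Param d, ‖v k‖ ^ 2 ∂μ :=
    Finset.sum_nonneg fun k _ => integral_nonneg fun v => by positivity
  -- The errors cost `2 * 3/8` of the sum of `‖v_k‖²`. The remaining quarter is nonnegative and is
  -- discarded.
  linarith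

lemma measurable_iterate_uncurry (I : Input) (θ₀ : Param d) (K : ℕ) :
    Measurable fun x : (ℕ → Param d) × Fin (K + 1) => iterate I θ₀ x.1 x.2 :=
  measurable_from_prod_countable_left fun k => measurable_iterate I θ₀ k

lemma isAccurate_of_isTuned (hC : Constants M π g L Lg Γ a) (hg : ∀ θ, Measurable (g θ))
    (hu : Unbiased M π g) (h : SmoothPolicy π) (hv : BoundedVariance M π g σ)
    (hI : I.IsTuned L (msConst Lg Γ a) σ) :
    IsAccurate M π g I θ₀ (numIter M π θ₀ L I.ε) := by
  set K := numIter M π θ₀ L I.ε with hK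
  have hprob := isProbabilityMeasure_runLaw (I := I) (θ₀ := θ₀) hC hg h (K + 1)
  have hm := measurable_iterate_uncurry I θ₀ K
  have hout : IsProbabilityMeasure (outputLaw M π g I θ₀ K) :=
    Measure.isProbabilityMeasure_map hm.aemeasurable
  refine ⟨hout, hC.integrable_gradient_sq hu _ measurable_id, ?_⟩
  have hL := hC.L_pos
  have hε := hI.ε_pos
  have hsum := sum_integral_gradient_sq_le (θ₀ := θ₀) hC hg hu h hv hI (K + 1)
  rw [outputLaw, integral_map hm.aemeasurable
      (hC.continuous_gradient.norm.fun_pow 2).aestronglyMeasurable,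
    integral_prod_symm _ (hC.integrable_gradient_sq hu _ hm), PMF.integral_eq_sum]
  simp only [PMF.uniformOfFintype_apply, Fintype.card_fin, smul_eq_mul, ← Finset.mul_sum]
  rw [Fin.sum_univ_eq_sum_range (fun k =>
    ∫ v, ‖gradient (objective M π) (iterate I θ₀ v k)‖ ^ 2 ∂(runLaw M π g I θ₀ (K + 1))),
    ENNReal.toReal_inv, ENNReal.toReal_natCast]
  -- Since `176 = 4 * 44`, the averaged bound is at most `ε/44 + ε/48`, well below `ε`.
  have hK1 : 176 * L * ((⨆ θ, objective M π θ) - objective M π θ₀) ≤ I.ε * (K + 1 : ℕ) := by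
    have h1 : 176 * L * ((⨆ θ, objective M π θ) - objective M π θ₀) / I.ε ≤ K := Nat.le_ceil _
    rw [div_le_iff₀ hε] at h1
    push_cast
    nlinarith
  have hpos : (0 : ℝ) < (K + 1 : ℕ) := by positivity
  rw [inv_mul_le_iff₀ hpos]
  nlinarith

end Accuracy

/-! ### Existence of the constants -/

section ExistsConstants

lemma norm_sum_smul_sum_le {n : ℕ} {c D : ℝ} (hc0 : 0 ≤ c) (hD0 : 0 ≤ D) {w : Fin n → ℝ}
    (hw : ∀ t, |w t| ≤ c) (s : Fin n → Finset (Fin n)) {u : Fin n → Param d}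
    (hu : ∀ i, ‖u i‖ ≤ D) : ‖∑ t, w t • ∑ i ∈ s t, u i‖ ≤ n * (c * (n * D)) := by
  refine (norm_sum_le_of_le (f := fun t => w t • ∑ i ∈ s t, u i) _ (n := fun _ => c * (n * D))
    fun t _ => ?_).trans_eq (by simp)
  rw [norm_smul, Real.norm_eq_abs]
  refine mul_le_mul (hw t) ?_ (norm_nonneg _) hc0
  refine (norm_sum_le_of_le _ fun i _ => hu i).trans ?_
  rw [Finset.sum_const, nsmul_eq_mul]
  refine mul_le_mul_of_nonneg_right (Nat.cast_le.2 ?_) hD0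
  simpa using Finset.card_le_univ (s t)

variable {M : MDP S A} {π : Policy S A d} {g : Param d → M.Traj → Param d}

/-- A common form for both estimators: the coefficients are bounded and free of `θ`, so bounds and
Lipschitz constants pass from the scores to `g`. -/
lemma IsStandardGradient.exists_eq_sum (hs : IsStandardGradient M π g) :
    ∃ (w : M.Traj → Fin M.horizon → ℝ) (s : Fin M.horizon → Finset (Fin M.horizon)) (c : ℝ),
      0 ≤ c ∧ (∀ τ t, |w τ t| ≤ c) ∧
      ∀ θ τ, g θ τ = ∑ t, w τ t • ∑ i ∈ s t, gradient (π.logDensity (τ i)) θ := by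
  obtain ⟨b, -, ⟨c, hc⟩, hgb⟩ := hs
  obtain ⟨R, hR⟩ := M.reward_bdd
  have hw : ∀ (τ : M.Traj) (t : Fin M.horizon),
      |M.disc ^ (t : ℕ) * M.reward (τ t) - b (τ t)| ≤ |R| + |c| := by
    intro τ t
    refine (abs_sub _ _).trans (add_le_add ?_ ((hc _).trans (le_abs_self c)))
    rw [abs_mul, abs_of_nonneg (pow_nonneg M.disc_nonneg _)]
    exact (mul_le_of_le_one_left (abs_nonneg _)
      (pow_le_one₀ M.disc_nonneg M.disc_lt_one.le)).trans ((hR _).trans (le_abs_self R))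
  rcases hgb with rfl | rfl
  · refine ⟨_, fun _ => Finset.univ, _, by positivity, hw, fun θ τ => ?_⟩
    rw [reinforce, Finset.sum_smul]
  · exact ⟨_, fun t => Finset.Iic t, _, by positivity, hw, fun θ τ => rfl⟩

lemma abs_exp_sub_one_le_mul_exp (z : ℝ) : |Real.exp z - 1| ≤ |z| * Real.exp |z| := by
  rcases le_total 0 z with hz | hz
  · rw [abs_of_nonneg hz, abs_of_nonneg (by linarith [Real.add_one_le_exp z])]
    have h1 := mul_le_mul_of_nonneg_left (Real.add_one_le_exp (-z)) (Real.exp_pos z).le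
    rw [← Real.exp_add, add_neg_cancel, Real.exp_zero] at h1
    linarith
  · rw [abs_of_nonpos hz, abs_of_nonpos (by linarith [Real.exp_le_one_iff.2 hz])]
    have h1 : 1 ≤ Real.exp (-z) := Real.one_le_exp (by linarith)
    nlinarith [Real.add_one_le_exp z]

/-- For parameters at distance at most `1` the log-weight is small and the estimate holds pointwise.
Farther apart, `E ω = 1` identifies the integral with the variance, and `‖θ₁ - θ₂‖² ≥ 1`. -/
lemma SmoothPolicy.exists_weight_variation_bound (h : SmoothPolicy π)
    (hW : BoundedWeightVariance M π) : ∃ a : ℝ, 0 < a ∧ ∀ θ₁ θ₂,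
      ∫ τ, (1 - weight M π θ₁ θ₂ τ) ^ 2 ∂(trajLaw M π θ₁) ≤ a * ‖θ₁ - θ₂‖ ^ 2 := by
  obtain ⟨D, hD0, hD⟩ := h.exists_score_bound
  obtain ⟨W, hW⟩ := hW
  set c : ℝ := M.horizon * D with hc
  have hc0 : 0 ≤ c := by positivity
  refine ⟨(c * Real.exp c) ^ 2 + |W| + 1, by positivity, fun θ₁ θ₂ => ?_⟩
  rcases le_total ‖θ₁ - θ₂‖ 1 with hle | hge
  · have hpt : ∀ τ, ‖(1 - weight M π θ₁ θ₂ τ) ^ 2‖ ≤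
        (c * Real.exp c) ^ 2 * ‖θ₁ - θ₂‖ ^ 2 := by
      intro τ
      rw [norm_pow, ← mul_pow]
      refine pow_le_pow_left₀ (norm_nonneg _) ?_ 2
      rw [Real.norm_eq_abs, abs_sub_comm, h.weight_eq_exp M]
      have hz := h.abs_log_weight_le M hD θ₁ θ₂ τ
      refine (abs_exp_sub_one_le_mul_exp _).trans ((mul_le_mul hz (Real.exp_le_exp.2
        (hz.trans (mul_le_of_le_one_right hc0 hle))) (Real.exp_pos _).le
        (by positivity)).trans_eq ?_)
      ring
    have := norm_integral_le_of_norm_le_const (μ := trajLaw M π θ₁) (Eventually.of_forall hpt)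
    simp only [probReal_univ, mul_one] at this
    refine (le_abs_self _).trans (this.trans (mul_le_mul_of_nonneg_right ?_ (sq_nonneg _)))
    linarith [abs_nonneg W]
  · have hvar := hW θ₁ θ₂
    rw [variance_eq_integral (measurable_weight M π θ₁ θ₂).aemeasurable,
      h.integral_weight M] at hvar
    have hflip : ∀ τ, (1 - weight M π θ₁ θ₂ τ) ^ 2 = (weight M π θ₁ θ₂ τ - 1) ^ 2 :=
      fun τ => by ring
    simp only [hflip]
    have h1 : 1 ≤ ‖θ₁ - θ₂‖ ^ 2 := one_le_pow₀ hge
    have h2 : 0 ≤ (c * Real.exp c) ^ 2 + |W| + 1 := by positivity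
    refine hvar.trans ((le_abs_self W).trans ?_)
    nlinarith [sq_nonneg (c * Real.exp c)]

/-- The gradient difference is the mean of `gradDiff`, so nonnegativity of the variance bounds its
square by the second moment. No constant `L` is presupposed. -/
lemma EstimatorBounds.lipschitz_gradient {Lg Γ a : ℝ} (hE : EstimatorBounds M π g Lg Γ a)
    (hg : ∀ θ, Measurable (g θ)) (hu : Unbiased M π g) (h : SmoothPolicy π) (θ₁ θ₂ : Param d) :
    ‖gradient (objective M π) θ₁ - gradient (objective M π) θ₂‖ ≤
      √(msConst Lg Γ a) * ‖θ₁ - θ₂‖ := by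
  obtain ⟨C, hC⟩ := hE.exists_gradDiff_bound h θ₁ θ₂
  have h1 := integral_norm_sub_mean_sq (trajLaw M π θ₁) (measurable_gradDiff hg θ₁ θ₂) hC
  have h2 : 0 ≤ ∫ τ, ‖gradDiff M π g θ₁ θ₂ τ - ∫ τ, gradDiff M π g θ₁ θ₂ τ ∂(trajLaw M π θ₁)‖ ^ 2
      ∂(trajLaw M π θ₁) := integral_nonneg fun τ => sq_nonneg _
  rw [h1, hE.integral_gradDiff hg hu h] at h2
  have h3 := hE.integral_gradDiff_sq_le h θ₁ θ₂
  rw [← Real.sqrt_sq (norm_nonneg (θ₁ - θ₂)), ← Real.sqrt_mul' _ (sq_nonneg _)]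
  exact Real.le_sqrt_of_sq_le (by linarith)

lemma exists_constants (hg : ∀ θ, Measurable (g θ)) (hu : Unbiased M π g) (h : SmoothPolicy π)
    (hs : IsStandardGradient M π g) (hW : BoundedWeightVariance M π) :
    ∃ L Lg Γ a : ℝ, Constants M π g L Lg Γ a := by
  obtain ⟨w, s, c, hc0, hw, hgs⟩ := hs.exists_eq_sum
  obtain ⟨D, hD0, hD⟩ := h.exists_score_bound
  obtain ⟨F, hF0, hF⟩ := h.exists_score_lipschitz
  obtain ⟨a, ha0, ha⟩ := h.exists_weight_variation_bound (M := M) hW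
  set n : ℝ := (M.horizon : ℝ) with hn
  have hn0 : 0 ≤ n := Nat.cast_nonneg _
  have hE : EstimatorBounds M π g (n * (c * (n * F))) ((n * (c * (n * D))) ^ 2 + 1) a := by
    refine ⟨by positivity, fun τ θ₁ θ₂ => ?_, fun τ θ => ?_, ha⟩
    · rw [hgs, hgs, ← Finset.sum_sub_distrib]
      simp only [← smul_sub, ← Finset.sum_sub_distrib]
      refine (norm_sum_smul_sum_le hc0 (by positivity) (hw τ) s
        fun i => hF (τ i) θ₁ θ₂).trans_eq ?_
      ring
    · have := norm_sum_smul_sum_le hc0 hD0 (hw τ) s fun i => hD (τ i) θ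
      rw [← hgs] at this
      linarith [pow_le_pow_left₀ (norm_nonneg _) this 2]
  have hQ : 0 < msConst (n * (c * (n * F))) ((n * (c * (n * D))) ^ 2 + 1) a := by
    unfold msConst
    positivity
  exact ⟨_, _, _, a, ⟨Real.sqrt_pos.2 hQ, by positivity, by positivity, ha0,
    hE.lipschitz_gradient hg hu h, hE.lip_g, hE.bdd_g, ha⟩⟩

end ExistsConstants

/-! ### Complexity -/

section Complexity

variable {M : MDP S A} {π : Policy S A d} {g : Param d → M.Traj → Param d}
  {θ₀ : Param d} {L Lg Γ a σ Q ε : ℝ}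

lemma isTuned_paramChoice (hL : 0 < L) (hQ : 0 < Q) (hσ : 0 < σ) (hε : 0 < ε) {β : ℝ}
    (hβ0 : 0 ≤ β) (hβ : β ≤ 6) : (paramChoice L Q σ β ε).IsTuned L Q σ := by
  have hm1 : 0 < (paramChoice L Q σ β ε).m := lt_max_of_lt_left one_pos
  refine ⟨rfl, hε, rfl, hσ, rfl, hβ0, hβ, hm1,
    Nat.ceil_pos.2 (Real.rpow_pos_of_pos (by positivity) _), ?_⟩
  set x := (L ^ 2 * σ ^ 2 / (Q * ε)) ^ (1 / 3 : ℝ) with hx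
  set y := (Q * σ ^ 4 / (L ^ 2 * ε ^ 2)) ^ (1 / 3 : ℝ) with hy
  have hcube : ∀ z : ℝ, 0 ≤ z → (z ^ (1 / 3 : ℝ)) ^ 3 = z := fun z hz => by
    rw [← Real.rpow_natCast, ← Real.rpow_mul hz]
    norm_num
  have hx3 : x ^ 3 = L ^ 2 * σ ^ 2 / (Q * ε) := hcube _ (by positivity)
  have hy3 : y ^ 3 = Q * σ ^ 4 / (L ^ 2 * ε ^ 2) := hcube _ (by positivity)
  have hx0 : 0 ≤ x := by positivity
  have hy0 : 0 ≤ y := by positivity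
  -- Before rounding, the tuning condition is an equality, checked on cubes. Rounding `m` down and
  -- `B` up preserves the inequality, and the case `m = 1` absorbs the lower cutoff of `m`.
  have hxy : Q * x ^ 2 = L ^ 2 * y := by
    refine (pow_left_inj₀ (by positivity) (by positivity) (by norm_num : 3 ≠ 0)).1 ?_
    calc (Q * x ^ 2) ^ 3 = Q ^ 3 * (x ^ 3) ^ 2 := by ring
      _ = (L ^ 2) ^ 3 * y ^ 3 := by
        rw [hx3, hy3]
        field_simp
      _ = (L ^ 2 * y) ^ 3 := by ring
  rcases le_or_gt ⌊x⌋₊ 1 with h1 | h1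
  · exact Or.inl (max_eq_left h1)
  · right
    have hm : (paramChoice L Q σ β ε).m = ⌊x⌋₊ := max_eq_right h1.le
    have h2 : (⌊x⌋₊ : ℝ) ≤ x := Nat.floor_le hx0
    have h3 : y ≤ (paramChoice L Q σ β ε).B := Nat.le_ceil y
    rw [hm]
    calc Q * (⌊x⌋₊ : ℝ) ^ 2 ≤ Q * x ^ 2 := by gcongr
      _ = L ^ 2 * y := hxy
      _ ≤ _ := by gcongr

lemma filter_range_mod_eq_zero {m : ℕ} (hm : 0 < m) (K : ℕ) :
    (Finset.range (K + 1)).filter (fun k => k % m = 0) =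
      (Finset.range (K / m + 1)).image (· * m) := by
  ext k
  simp only [Finset.mem_filter, Finset.mem_range, Finset.mem_image, Nat.lt_succ_iff]
  constructor
  · rintro ⟨hk, h0⟩
    exact ⟨k / m, Nat.div_le_div_right hk, Nat.div_mul_cancel (Nat.dvd_of_mod_eq_zero h0)⟩
  · rintro ⟨j, hj, rfl⟩
    exact ⟨(Nat.le_div_iff_mul_le hm).1 hj, Nat.mul_mod_left _ _⟩

lemma stoCount_le {I : Input} (hI : I.IsTuned L Q σ) (K : ℕ) (v : ℕ → Param d) :
    (stoCount I K v : ℝ) ≤ stoComplexity I K v + (K / I.m + 1 : ℕ) := by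
  have hm := hI.m_pos
  -- Iteration `0` is always outer, so at most `K` of the `K + 1` iterations are inner.
  have hinner : ((Finset.range (K + 1)).filter fun k => ¬ k % I.m = 0).card ≤ K := by
    have h1 := Finset.card_filter_add_card_filter_not (s := Finset.range (K + 1))
      fun k => k % I.m = 0
    have h2 : 0 < ((Finset.range (K + 1)).filter fun k => k % I.m = 0).card :=
      Finset.card_pos.2 ⟨0, by simp⟩
    rw [Finset.card_range] at h1
    omega
  have houter : ∑ k ∈ (Finset.range (K + 1)).filter (fun k => k % I.m = 0), (batch I v k : ℝ) ≤
      ∑ k ∈ Finset.range (K / I.m + 1), batchReal I v (k * I.m) + (K / I.m + 1 : ℕ) := by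
    rw [filter_range_mod_eq_zero hm, Finset.sum_image fun i _ j _ hij =>
      Nat.eq_of_mul_eq_mul_right hm hij]
    refine (Finset.sum_le_sum fun k _ =>
      (Nat.ceil_lt_add_one (hI.batchReal_pos v (k * I.m)).le).le).trans_eq ?_
    simp [Finset.sum_add_distrib]
  rw [stoCount, Finset.sum_ite, Finset.sum_const, smul_eq_mul, stoComplexity]
  push_cast at houter ⊢
  have h3 := mul_le_mul_of_nonneg_right (Nat.cast_le (α := ℝ).2 hinner)
    (by positivity : (0 : ℝ) ≤ 2 * I.B)
  linarith

/-! ### Comparison of the adaptive and the vanilla complexity -/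

lemma batchReal_vanilla (v : ℕ → Param d) (n : ℕ) :
    batchReal (vanilla L Q σ ε) v n = 48 * σ ^ 2 / ε := by
  simp [batchReal, vanilla, paramChoice]

lemma stoComplexity_vanilla (K : ℕ) (v : ℕ → Param d) :
    stoComplexity (vanilla L Q σ ε) K v = 2 * K * (vanilla L Q σ ε).B +
      (K / (vanilla L Q σ ε).m + 1 : ℕ) * (48 * σ ^ 2 / ε) := by
  simp [stoComplexity, batchReal_vanilla]

lemma batchReal_aba_le (hσ : 0 < σ) (hε : 0 < ε) (v : ℕ → Param d) (n : ℕ) :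
    batchReal (aba L Q σ ε) v n ≤ 48 * σ ^ 2 / ε :=
  div_le_div_of_nonneg_left (show 0 ≤ 48 * σ ^ 2 by positivity) hε (le_add_of_nonneg_left
    (mul_nonneg (div_nonneg (by norm_num [aba, paramChoice]) (Nat.cast_nonneg _))
      (Finset.sum_nonneg fun i _ => sq_nonneg _)))

lemma batchReal_aba_lt_iff (hσ : 0 < σ) (hε : 0 < ε) (v : ℕ → Param d) (n : ℕ) :
    batchReal (aba L Q σ ε) v n < 48 * σ ^ 2 / ε ↔
      ∃ i ∈ Finset.Ico (n - (aba L Q σ ε).m) n, v i ≠ 0 := by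
  have hm : 0 < (aba L Q σ ε).m := lt_max_of_lt_left one_pos
  constructor
  · intro hlt
    by_contra! hz
    refine hlt.ne ?_
    rw [batchReal, Finset.sum_eq_zero fun i hi => by rw [hz i hi, norm_zero]; norm_num]
    simp [aba, paramChoice]
  · rintro ⟨i, hi, hvi⟩
    have hsum : 0 < ∑ i ∈ Finset.Ico (n - (aba L Q σ ε).m) n, ‖v i‖ ^ 2 :=
      Finset.sum_pos' (fun i _ => sq_nonneg _) ⟨i, hi, by positivity⟩
    exact div_lt_div_of_pos_left (show 0 < 48 * σ ^ 2 by positivity) hε (lt_add_of_pos_left _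
      (mul_pos (div_pos (by norm_num [aba, paramChoice]) (Nat.cast_pos.2 hm)) hsum))

lemma stoComplexity_aba_le (hσ : 0 < σ) (hε : 0 < ε) (K : ℕ) (v w : ℕ → Param d) :
    stoComplexity (aba L Q σ ε) K v ≤ stoComplexity (vanilla L Q σ ε) K w :=
  add_le_add le_rfl (Finset.sum_le_sum fun k _ => by
    rw [batchReal_vanilla]
    exact batchReal_aba_le hσ hε v _)

/-- The termwise inequality is strict in sum iff it is strict somewhere, and the windows `[km - m,
km)` for `1 ≤ k ≤ K / m` tile `[0, n_K)`. -/
lemma stoComplexity_aba_lt_iff (hσ : 0 < σ) (hε : 0 < ε) (K : ℕ) (v w : ℕ → Param d) :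
    stoComplexity (aba L Q σ ε) K v < stoComplexity (vanilla L Q σ ε) K w ↔
      ∃ i < epochStart (aba L Q σ ε) K, v i ≠ 0 := by
  have hm : 0 < (aba L Q σ ε).m := lt_max_of_lt_left one_pos
  have hkey : stoComplexity (aba L Q σ ε) K v < stoComplexity (vanilla L Q σ ε) K w ↔
      ∃ k ∈ Finset.range (K / (aba L Q σ ε).m + 1),
        batchReal (aba L Q σ ε) v (k * (aba L Q σ ε).m) < 48 * σ ^ 2 / ε := by
    have hsplit : stoComplexity (aba L Q σ ε) K v < stoComplexity (vanilla L Q σ ε) K w ↔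
        ∑ k ∈ Finset.range (K / (aba L Q σ ε).m + 1),
          batchReal (aba L Q σ ε) v (k * (aba L Q σ ε).m) <
        ∑ _k ∈ Finset.range (K / (aba L Q σ ε).m + 1), 48 * σ ^ 2 / ε := by
      unfold stoComplexity
      simp only [batchReal_vanilla]
      exact add_lt_add_iff_left _
    rw [hsplit]
    constructor
    · exact Finset.exists_lt_of_sum_lt
    · exact fun h => Finset.sum_lt_sum (fun k _ => batchReal_aba_le hσ hε v _) h
  rw [hkey]
  set m := (aba L Q σ ε).m with hm'
  constructor
  · rintro ⟨k, hk, hlt⟩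
    obtain ⟨i, hi, hvi⟩ := (batchReal_aba_lt_iff hσ hε v _).1 hlt
    exact ⟨i, (Finset.mem_Ico.1 hi).2.trans_le
      (Nat.mul_le_mul_right m (Nat.lt_succ_iff.1 (Finset.mem_range.1 hk))), hvi⟩
  · rintro ⟨i, hi, hvi⟩
    have h1 : i / m < K / m := (Nat.div_lt_iff_lt_mul hm).2 hi
    refine ⟨i / m + 1, Finset.mem_range.2 (by omega), (batchReal_aba_lt_iff hσ hε v _).2
      ⟨i, Finset.mem_Ico.2 ?_, hvi⟩⟩
    rw [← hm', Nat.succ_mul]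
    have := Nat.div_add_mod' i m
    have := Nat.mod_lt i hm
    omega

lemma objective_lt_iSup (hθ : gradient (objective M π) θ₀ ≠ 0) :
    objective M π θ₀ < ⨆ θ, objective M π θ := by
  by_contra! hle
  refine hθ ?_
  have hmax : IsLocalMax (objective M π) θ₀ :=
    Eventually.of_forall fun θ => (le_ciSup (bddAbove_objective M π) θ).trans hle
  rw [gradient, hmax.fderiv_eq_zero, map_zero]

/-- The epoch length grows like `ε^(-1/3)` and `K` like `ε⁻¹`, so at least one epoch is eventually
completed. -/
lemma eventually_epoch_le_numIter (hL : 0 < L) (hQ : 0 < Q)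
    (hJ : objective M π θ₀ < ⨆ θ, objective M π θ) :
    ∀ᶠ ε in 𝓝[>] (0 : ℝ), (aba L Q σ ε).m ≤ numIter M π θ₀ L ε := by
  set c := L ^ 2 * σ ^ 2 / Q with hc
  have hc0 : 0 ≤ c := by positivity
  -- The function is `ε * (x + 1)`, where `x` is the unrounded epoch length and `m ≤ x + 1`.
  have hlim : Tendsto (fun ε : ℝ => c ^ (1 / 3 : ℝ) * ε ^ (2 / 3 : ℝ) + ε) (𝓝[>] 0) (𝓝 0) := by
    have hcont : Continuous fun ε : ℝ => c ^ (1 / 3 : ℝ) * ε ^ (2 / 3 : ℝ) + ε :=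
      ((Real.continuous_rpow_const (by norm_num)).const_mul _).add continuous_id
    have := hcont.tendsto 0
    rw [Real.zero_rpow (by norm_num), mul_zero, add_zero] at this
    exact this.mono_left nhdsWithin_le_nhds
  have hpos : 0 < 176 * L * ((⨆ θ, objective M π θ) - objective M π θ₀) :=
    mul_pos (by positivity) (sub_pos.2 hJ)
  filter_upwards [hlim.eventually (gt_mem_nhds hpos), self_mem_nhdsWithin] with ε hlt hε
  have hε : 0 < ε := hε
  set x := (L ^ 2 * σ ^ 2 / (Q * ε)) ^ (1 / 3 : ℝ) with hx
  have hx0 : 0 ≤ x := by positivity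
  have hxe : x * ε = c ^ (1 / 3 : ℝ) * ε ^ (2 / 3 : ℝ) := by
    have h1 : ε ^ (2 / 3 : ℝ) * ε ^ (1 / 3 : ℝ) = ε := by
      rw [← Real.rpow_add hε]
      norm_num
    rw [hx, ← div_div, ← hc, Real.div_rpow hc0 hε.le, div_mul_eq_mul_div,
      div_eq_iff (Real.rpow_pos_of_pos hε _).ne', mul_assoc, h1]
  have hmx : ((aba L Q σ ε).m : ℝ) ≤ x + 1 := by
    have : ((aba L Q σ ε).m : ℝ) = max 1 (⌊x⌋₊ : ℝ) := by simp [aba, paramChoice, hx]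
    rw [this]
    exact max_le (by linarith) ((Nat.floor_le hx0).trans (by linarith))
  have hK : 176 * L * ((⨆ θ, objective M π θ) - objective M π θ₀) / ε ≤ numIter M π θ₀ L ε :=
    Nat.le_ceil _
  refine Nat.cast_le (α := ℝ).1 (hmx.trans (le_trans ?_ hK))
  rw [le_div_iff₀ hε]
  linarith

lemma integrable_stoComplexity_aba {μ : Measure (ℕ → Param d)} [IsFiniteMeasure μ]
    (hL : 0 < L) (hQ : 0 < Q) (hσ : 0 < σ) (hε : 0 < ε) (K : ℕ) :
    Integrable (stoComplexity (aba L Q σ ε) K) μ := by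
  have hI : (aba L Q σ ε).IsTuned L Q σ :=
    isTuned_paramChoice hL hQ hσ hε (by norm_num) le_rfl
  refine Integrable.of_bound (C := stoComplexity (vanilla L Q σ ε) K (0 : ℕ → Param d)) ?_
    (Eventually.of_forall fun v => ?_)
  · unfold stoComplexity
    exact (measurable_const.add
      (Finset.measurable_sum _ fun k _ => measurable_batchReal _ _)).aestronglyMeasurable
  · rw [Real.norm_of_nonneg]
    · exact stoComplexity_aba_le hσ hε K v 0
    · exact add_nonneg (by positivity) (Finset.sum_nonneg fun k _ => (hI.batchReal_pos v _).le)

lemma integral_stoComplexity_aba_lt (hC : Constants M π g L Lg Γ a) (hg : ∀ θ, Measurable (g θ))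
    (hu : Unbiased M π g) (h : SmoothPolicy π) (hv : BoundedVariance M π g σ) (hσ : 0 < σ)
    (hε : 0 < ε) (hεs : ε / 48 < ‖gradient (objective M π) θ₀‖ ^ 2) {K : ℕ}
    (hK : (aba L (msConst Lg Γ a) σ ε).m ≤ K) (w : ℕ → Param d) :
    ∫ v, stoComplexity (aba L (msConst Lg Γ a) σ ε) K v
        ∂(runLaw M π g (aba L (msConst Lg Γ a) σ ε) θ₀ (K + 1)) <
      stoComplexity (vanilla L (msConst Lg Γ a) σ ε) K w := by
  set I := aba L (msConst Lg Γ a) σ ε with hIdef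
  have hI : I.IsTuned L (msConst Lg Γ a) σ :=
    isTuned_paramChoice hC.L_pos hC.msConst_pos hσ hε (by norm_num) le_rfl
  have hprob := isProbabilityMeasure_runLaw (I := I) (θ₀ := θ₀) hC hg h (K + 1)
  set μ := runLaw M π g I θ₀ (K + 1)
  have hint : Integrable (stoComplexity I K) μ :=
    integrable_stoComplexity_aba hC.L_pos hC.msConst_pos hσ hε K
  have hle : ∀ v, 0 ≤ stoComplexity (vanilla L (msConst Lg Γ a) σ ε) K w - stoComplexity I K v :=
    fun v => sub_nonneg.2 (stoComplexity_aba_le hσ hε K v w)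
  by_contra! hge
  have hzero : ∫ v, (stoComplexity (vanilla L (msConst Lg Γ a) σ ε) K w -
      stoComplexity I K v) ∂μ = 0 := by
    refine le_antisymm ?_ (integral_nonneg hle)
    rw [integral_sub (integrable_const _) hint, integral_const, probReal_univ, one_smul]
    linarith
  rw [integral_eq_zero_iff_of_nonneg hle ((integrable_const _).sub hint)] at hzero
  have hstart : 0 < epochStart I K := Nat.mul_pos (Nat.div_pos hK hI.m_pos) hI.m_pos
  -- Equal expectations force equality almost surely, hence `v_0 = 0`, and the error of step `0` is
  -- then the full squared gradient. Its bound is `ε/48`, as no epoch precedes it.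
  have hv0 : ∀ᵐ v ∂μ, errorSq M π I θ₀ 0 v = ‖gradient (objective M π) θ₀‖ ^ 2 := by
    filter_upwards [hzero] with v hv
    have hnlt : ¬ stoComplexity I K v < stoComplexity (vanilla L (msConst Lg Γ a) σ ε) K w := by
      have : stoComplexity (vanilla L (msConst Lg Γ a) σ ε) K w - stoComplexity I K v = 0 := hv
      linarith
    rw [hIdef, stoComplexity_aba_lt_iff hσ hε] at hnlt
    push Not at hnlt
    simp [errorSq, hnlt 0 hstart, iterate]
  have herr := integral_errorSq_le (θ₀ := θ₀) hC hg hu h hv hI (Nat.succ_pos K)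
  rw [Nat.succ_eq_add_one, integral_congr_ae hv0] at herr
  simp [affineErrorBound] at herr
  have hIε : I.ε = ε := rfl
  rw [hIε] at herr
  linarith

/-- The complexity of vanilla SVRPG, including the rounding of the outer batch sizes. -/
lemma exists_complexity_bound (hL : 0 < L) (hQ : 0 < Q) (hσ : 0 < σ) :
    ∃ C : ℝ, ∀ ε : ℝ, 0 < ε → ε ≤ 1 → ∀ v : ℕ → Param d,
      stoComplexity (vanilla L Q σ ε) (numIter M π θ₀ L ε) v +
        (numIter M π θ₀ L ε / (vanilla L Q σ ε).m + 1 : ℕ) ≤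
      C * (ε ^ (-(5 / 3) : ℝ) + ε ^ (-1 : ℝ)) := by
  set c₁ := 176 * L * ((⨆ θ, objective M π θ) - objective M π θ₀) with hc₁
  have hc₁0 : 0 ≤ c₁ :=
    mul_nonneg (by positivity) (sub_nonneg.2 (le_ciSup (bddAbove_objective M π) θ₀))
  set cx := (L ^ 2 * σ ^ 2 / Q) ^ (1 / 3 : ℝ) with hcx
  have hcx0 : 0 < cx := Real.rpow_pos_of_pos (by positivity) _
  set cy := (Q * σ ^ 4 / L ^ 2) ^ (1 / 3 : ℝ) with hcy
  have hcy0 : 0 < cy := Real.rpow_pos_of_pos (by positivity) _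
  refine ⟨2 * (c₁ + 1) * (cy + 1) + (48 * σ ^ 2 + 1) * (2 * (c₁ + 1) / cx + 1),
    fun ε hε hε1 v => ?_⟩
  -- With `t = ε^(-1/3) ≥ 1` every quantity is bounded by a power of `t`: `K ≲ t³`, `B ≲ t²`, `K / m
  -- ≲ t²`. Additive constants from rounding are absorbed by `t ≥ 1`.
  set t := ε ^ (-(1 / 3) : ℝ) with ht
  have ht0 : 0 < t := Real.rpow_pos_of_pos hε _
  have ht1 : 1 ≤ t := Real.one_le_rpow_of_pos_of_le_one_of_nonpos hε hε1 (by norm_num)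
  have htpow : ∀ n : ℕ, t ^ n = ε ^ (-(n / 3) : ℝ) := fun n => by
    rw [ht, ← Real.rpow_natCast, ← Real.rpow_mul hε.le]
    ring_nf
  have ht5 : ε ^ (-(5 / 3) : ℝ) = t ^ 5 := by rw [htpow]; norm_num
  have ht3 : ε ^ (-1 : ℝ) = t ^ 3 := by rw [htpow]; norm_num
  have hinv : ∀ z : ℝ, z / ε = z * t ^ 3 := fun z => by
    rw [← ht3, Real.rpow_neg_one, div_eq_mul_inv]
  have hx : (L ^ 2 * σ ^ 2 / (Q * ε)) ^ (1 / 3 : ℝ) = cx * t := by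
    rw [← div_div, Real.div_rpow (by positivity) hε.le, ht, Real.rpow_neg hε.le, div_eq_mul_inv]
  have hy : (Q * σ ^ 4 / (L ^ 2 * ε ^ 2)) ^ (1 / 3 : ℝ) = cy * t ^ 2 := by
    rw [← div_div, Real.div_rpow (by positivity) (by positivity), htpow, ← Real.rpow_natCast ε 2,
      ← Real.rpow_mul hε.le, div_eq_mul_inv, ← Real.rpow_neg hε.le, ← hcy]
    norm_num
  have hK : (numIter M π θ₀ L ε : ℝ) ≤ (c₁ + 1) * t ^ 3 := by
    have h1 : (numIter M π θ₀ L ε : ℝ) < c₁ / ε + 1 :=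
      Nat.ceil_lt_add_one (div_nonneg hc₁0 hε.le)
    rw [hinv] at h1
    linarith [one_le_pow₀ (n := 3) ht1]
  have hB : ((vanilla L Q σ ε).B : ℝ) ≤ (cy + 1) * t ^ 2 := by
    have h1 : ((vanilla L Q σ ε).B : ℝ) <
        (Q * σ ^ 4 / (L ^ 2 * ε ^ 2)) ^ (1 / 3 : ℝ) + 1 := Nat.ceil_lt_add_one (by positivity)
    rw [hy] at h1
    linarith [one_le_pow₀ (n := 2) ht1]
  -- Since `max 1 ⌊z⌋ ≥ z / 2`, rounding the epoch length down costs at most a factor `2`.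
  have hm : cx * t ≤ 2 * (vanilla L Q σ ε).m := by
    have h1 : ((vanilla L Q σ ε).m : ℝ) = max 1 (⌊cx * t⌋₊ : ℝ) := by
      rw [← hx]
      simp [vanilla, paramChoice]
    have h2 := Nat.lt_floor_add_one (cx * t)
    rw [h1]
    linarith [le_max_left 1 (⌊cx * t⌋₊ : ℝ), le_max_right 1 (⌊cx * t⌋₊ : ℝ)]
  have hm0 : (0 : ℝ) < (vanilla L Q σ ε).m := by
    have := mul_pos hcx0 ht0
    linarith
  have hKm : ((numIter M π θ₀ L ε / (vanilla L Q σ ε).m : ℕ) : ℝ) ≤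
      2 * (c₁ + 1) / cx * t ^ 2 := by
    refine Nat.cast_div_le.trans ?_
    rw [div_le_iff₀ hm0]
    calc (numIter M π θ₀ L ε : ℝ) ≤ (c₁ + 1) * t ^ 3 := hK
      _ = (c₁ + 1) / cx * t ^ 2 * (cx * t) := by field_simp
      _ ≤ (c₁ + 1) / cx * t ^ 2 * (2 * (vanilla L Q σ ε).m) := by gcongr
      _ = 2 * (c₁ + 1) / cx * t ^ 2 * (vanilla L Q σ ε).m := by ring
  rw [stoComplexity_vanilla, ht5, ht3, hinv]
  have h1 : 2 * (numIter M π θ₀ L ε : ℝ) * (vanilla L Q σ ε).B ≤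
      2 * ((c₁ + 1) * t ^ 3) * ((cy + 1) * t ^ 2) := by gcongr
  have h2 : ((numIter M π θ₀ L ε / (vanilla L Q σ ε).m + 1 : ℕ) : ℝ) *
      (48 * σ ^ 2 * t ^ 3 + 1) ≤
        (2 * (c₁ + 1) / cx * t ^ 2 + 1) * ((48 * σ ^ 2 + 1) * t ^ 3) := by
    push_cast
    have h3 := one_le_pow₀ (n := 3) ht1
    gcongr
    linarith
  set q := 2 * (c₁ + 1) / cx with hq
  have hq0 : 0 ≤ q := by positivity
  have h5 : 0 ≤ t ^ 5 := by positivity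
  have h3 : 0 ≤ t ^ 3 := by positivity
  have h6 : 2 * ((c₁ + 1) * t ^ 3) * ((cy + 1) * t ^ 2) = 2 * (c₁ + 1) * (cy + 1) * t ^ 5 := by ring
  have h7 : (q * t ^ 2 + 1) * ((48 * σ ^ 2 + 1) * t ^ 3) =
      (48 * σ ^ 2 + 1) * (q * t ^ 5 + t ^ 3) := by ring
  have h8 : 0 ≤ 2 * (c₁ + 1) * (cy + 1) * t ^ 3 := by positivity
  have h9 : 0 ≤ (48 * σ ^ 2 + 1) * (q * t ^ 3 + t ^ 5) := by positivity
  linarith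

end Complexity

end SVRPG

end

theorem corollary3 {S A : Type*} [MeasurableSpace S] [MeasurableSpace A] {d : ℕ}
    (M : SVRPG.MDP S A) (π : SVRPG.Policy S A d)
    (g : SVRPG.Param d → M.Traj → SVRPG.Param d) (hg : ∀ θ, Measurable (g θ))
    (h_unbiased : SVRPG.Unbiased M π g) (h_smooth : SVRPG.SmoothPolicy π)
    (σ : ℝ) (hσ : 0 < σ) (h_var : SVRPG.BoundedVariance M π g σ) (θ₀ : SVRPG.Param d) :
    -- the constants exist for the standard trajectory gradients
    (SVRPG.IsStandardGradient M π g → SVRPG.BoundedWeightVariance M π →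
      ∃ L Lg Γ a : ℝ, SVRPG.Constants M π g L Lg Γ a) ∧
    ∀ L Lg Γ a Q : ℝ, SVRPG.Constants M π g L Lg Γ a → Q = SVRPG.msConst Lg Γ a →
      -- after `K` iterations the required accuracy is achieved, with and without adaptation
      (∀ ε : ℝ, 0 < ε →
        SVRPG.IsAccurate M π g (SVRPG.aba L Q σ ε) θ₀ (SVRPG.numIter M π θ₀ L ε) ∧
        SVRPG.IsAccurate M π g (SVRPG.vanilla L Q σ ε) θ₀ (SVRPG.numIter M π θ₀ L ε)) ∧
      -- the complexity expressions bound the numbers of oracle calls, up to the rounding of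
      -- the outer batch sizes
      (∀ ε : ℝ, 0 < ε → ∀ v : ℕ → SVRPG.Param d, ∀ I : SVRPG.Input,
        I = SVRPG.aba L Q σ ε ∨ I = SVRPG.vanilla L Q σ ε →
        (SVRPG.stoCount I (SVRPG.numIter M π θ₀ L ε) v : ℝ) ≤
          SVRPG.stoComplexity I (SVRPG.numIter M π θ₀ L ε) v +
            (SVRPG.numIter M π θ₀ L ε / I.m + 1 : ℕ)) ∧
      -- comparison on every run, strict exactly if a direction in a completed epoch is nonzero
      (∀ ε : ℝ, 0 < ε → ∀ v : ℕ → SVRPG.Param d,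
        SVRPG.stoComplexity (SVRPG.aba L Q σ ε) (SVRPG.numIter M π θ₀ L ε) v ≤
          SVRPG.stoComplexity (SVRPG.vanilla L Q σ ε) (SVRPG.numIter M π θ₀ L ε) v ∧
        (SVRPG.stoComplexity (SVRPG.aba L Q σ ε) (SVRPG.numIter M π θ₀ L ε) v <
            SVRPG.stoComplexity (SVRPG.vanilla L Q σ ε) (SVRPG.numIter M π θ₀ L ε) v ↔
          ∃ i < SVRPG.epochStart (SVRPG.aba L Q σ ε) (SVRPG.numIter M π θ₀ L ε), v i ≠ 0)) ∧
      -- strict comparison in expectation, unless the initial point is already stationary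
      (gradient (SVRPG.objective M π) θ₀ ≠ 0 → ∀ᶠ ε in 𝓝[>] (0 : ℝ),
        ∀ w : ℕ → SVRPG.Param d,
        Integrable (SVRPG.stoComplexity (SVRPG.aba L Q σ ε) (SVRPG.numIter M π θ₀ L ε))
          (SVRPG.runLaw M π g (SVRPG.aba L Q σ ε) θ₀ (SVRPG.numIter M π θ₀ L ε + 1)) ∧
        ∫ v, SVRPG.stoComplexity (SVRPG.aba L Q σ ε) (SVRPG.numIter M π θ₀ L ε) v
            ∂(SVRPG.runLaw M π g (SVRPG.aba L Q σ ε) θ₀ (SVRPG.numIter M π θ₀ L ε + 1)) <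
          SVRPG.stoComplexity (SVRPG.vanilla L Q σ ε) (SVRPG.numIter M π θ₀ L ε) w) ∧
      -- the complexity of vanilla SVRPG, which does not depend on the run
      (∀ v : ℕ → SVRPG.Param d,
        (fun ε : ℝ => SVRPG.stoComplexity (SVRPG.vanilla L Q σ ε) (SVRPG.numIter M π θ₀ L ε) v)
          =O[𝓝[>] 0] fun ε : ℝ => ε ^ (-(5 / 3) : ℝ) + ε ^ (-1 : ℝ)) ∧
      -- hence the worst-case number of oracle calls of AbaSVRPG
      (∃ C : ℝ, ∀ᶠ ε in 𝓝[>] (0 : ℝ), ∀ v : ℕ → SVRPG.Param d,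
        (SVRPG.stoCount (SVRPG.aba L Q σ ε) (SVRPG.numIter M π θ₀ L ε) v : ℝ) ≤
          C * (ε ^ (-(5 / 3) : ℝ) + ε ^ (-1 : ℝ))) := by
  refine ⟨SVRPG.exists_constants hg h_unbiased h_smooth, ?_⟩
  rintro L Lg Γ a _ hC rfl
  have hL := hC.L_pos
  have hQ := hC.msConst_pos
  have haba : ∀ ε : ℝ, 0 < ε →
      (SVRPG.aba L (SVRPG.msConst Lg Γ a) σ ε).IsTuned L (SVRPG.msConst Lg Γ a) σ := fun ε hε =>
    SVRPG.isTuned_paramChoice hL hQ hσ hε (by norm_num) le_rfl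
  have hvan : ∀ ε : ℝ, 0 < ε →
      (SVRPG.vanilla L (SVRPG.msConst Lg Γ a) σ ε).IsTuned L (SVRPG.msConst Lg Γ a) σ :=
    fun ε hε => SVRPG.isTuned_paramChoice hL hQ hσ hε le_rfl (by norm_num)
  obtain ⟨C, hbound⟩ := SVRPG.exists_complexity_bound (M := M) (π := π) (θ₀ := θ₀) hL hQ hσ
  have hsmall : ∀ᶠ ε in 𝓝[>] (0 : ℝ), 0 < ε ∧ ε ≤ 1 := by
    filter_upwards [Ioc_mem_nhdsGT (zero_lt_one' ℝ)] with ε hε using hε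
  refine ⟨fun ε hε => ⟨?_, ?_⟩, ?_, fun ε hε v => ⟨SVRPG.stoComplexity_aba_le hσ hε _ v v,
    SVRPG.stoComplexity_aba_lt_iff hσ hε _ v v⟩, fun hgrad => ?_, fun v => ?_, C, ?_⟩
  · exact SVRPG.isAccurate_of_isTuned hC hg h_unbiased h_smooth h_var (haba ε hε)
  · exact SVRPG.isAccurate_of_isTuned hC hg h_unbiased h_smooth h_var (hvan ε hε)
  · rintro ε hε v I (rfl | rfl)
    · exact SVRPG.stoCount_le (haba ε hε) _ v
    · exact SVRPG.stoCount_le (hvan ε hε) _ v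
  · have hpos : 0 < 48 * ‖gradient (SVRPG.objective M π) θ₀‖ ^ 2 := by positivity
    filter_upwards [Ioo_mem_nhdsGT hpos, SVRPG.eventually_epoch_le_numIter (σ := σ) hL hQ
      (SVRPG.objective_lt_iSup hgrad)] with ε hε hK w
    have hprob := SVRPG.isProbabilityMeasure_runLaw (θ₀ := θ₀)
      (I := SVRPG.aba L (SVRPG.msConst Lg Γ a) σ ε) hC hg h_smooth
      (SVRPG.numIter M π θ₀ L ε + 1)
    exact ⟨SVRPG.integrable_stoComplexity_aba hL hQ hσ hε.1 _,
      SVRPG.integral_stoComplexity_aba_lt hC hg h_unbiased h_smooth h_var hσ hε.1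
        (by linarith [hε.2]) hK w⟩
  · refine IsBigO.of_bound C ?_
    filter_upwards [hsmall] with ε hε
    have hsum : 0 ≤ ε ^ (-(5 / 3) : ℝ) + ε ^ (-1 : ℝ) :=
      add_nonneg (Real.rpow_nonneg hε.1.le _) (Real.rpow_nonneg hε.1.le _)
    have hnonneg : 0 ≤ SVRPG.stoComplexity (SVRPG.vanilla L (SVRPG.msConst Lg Γ a) σ ε)
        (SVRPG.numIter M π θ₀ L ε) v :=
      add_nonneg (by positivity)
        (Finset.sum_nonneg fun k _ => ((hvan ε hε.1).batchReal_pos v _).le)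
    rw [Real.norm_of_nonneg hnonneg, Real.norm_of_nonneg hsum]
    exact (le_add_of_nonneg_right (Nat.cast_nonneg _)).trans (hbound ε hε.1 hε.2 v)
  · filter_upwards [hsmall] with ε hε v
    exact (SVRPG.stoCount_le (haba ε hε.1) _ v).trans ((add_le_add_left
      (SVRPG.stoComplexity_aba_le hσ hε.1 _ v v) _).trans (hbound ε hε.1 hε.2 v))
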